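/- Let $q\in\mathbb{C}\setminus\{0\}$ with $q^n\neq 1$ for all nonzero integers $n$. Let $\mathbb{C}_q[x,y]$ be the unital $\mathbb{C}$-algebra generated by $x,y$ with the relation $yx=qxy$, and for $p\in\mathbb{C}_q[x,y]$ let $(p)_i$ be its homogeneous component of degree $i$, i.e. its projection to the span of the monomials $x^my^n$ with $m+n=i$. Let $U_q(\mathfrak{sl}_2)$ be the Hopf algebra with generators $k,k^{-1},e,f$, relations $kk^{-1}=k^{-1}k=1$, $ke=q^2ek$, $kf=q^{-2}fk$, $ef-fe=\frac{k-k^{-1}}{q-q^{-1}}$, comultiplication $\Delta(k)=k\otimes k$, $\Delta(e)=1\otimes e+e\otimes k$, $\Delta(f)=f\otimes 1+k^{-1}\otimes f$, and counit $\varepsilon(k)=1$, $\varepsilon(e)=\varepsilon(f)=0$. A $U_q(\mathfrak{sl}_2)$-module algebra structure on $A=\mathbb{C}_q[x,y]$ is an algebra homomorphism $\pi:U_q(\mathfrak{sl}_2)\to\operatorname{End}_{\mathbb{C}}A$ with $\pi(h)(ab)=\sum\pi(h')(a)\,\pi(h'')(b)$, where $\Delta(h)=\sum h'\otimes h''$,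 and $\pi(h)(1)=\varepsilon(h)1$; structures $\pi_1,\pi_2$ are isomorphic if $\Psi\pi_1(h)\Psi^{-1}=\pi_2(h)$ for all $h$, for some algebra automorphism $\Psi$ of $A$. Write $h(a)=\pi(h)(a)$. To a structure and $i\in\{0,1\}$ associate the symbolic matrix $S_i\in\{0,\star\}^{2\times 2}$ obtained from $\begin{pmatrix}(e(x))_i&(e(y))_i\\(f(x))_i&(f(y))_i\end{pmatrix}$ by replacing each nonzero entry by $\star$ and each zero entry by $0$. The $[S_0;S_1]$-series is the set of all structures with these two symbolic matrices. Consider the following six series. 1. $\left[\begin{pmatrix}0&0\\0&0\end{pmatrix};\begin{pmatrix}0&0\\0&0\end{pmatrix}\right]$: $k(x)=\pm x$, $k(y)=\pm y$ (independent signs), $e(x)=e(y)=f(x)=f(y)=0$. 2. $\left[\begin{pmatrix}0&0\\0&0\end{pmatrix};\begin{pmatrix}0&\star\\\star&0\end{pmatrix}\right]$: $k(x)=qx$, $k(y)=q^{-1}y$, $e(x)=0$, $e(y)=\tau x$, $f(x)=\tau^{-1}y$, $f(y)=0$, with $\tau\in\mathbb{C}\setminus\{0\}$. 3. $\left[\begin{pmatrix}0&\star\\0&0\end{pmatrix};\begin{pmatrix}0&0\\0&0\end{pmatrix}\right]$: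 $k(x)=qx$, $k(y)=q^{-2}y$, $e(x)=0$, $e(y)=b_0$, $f(x)=b_0^{-1}xy$, $f(y)=-qb_0^{-1}y^2$, with $b_0\in\mathbb{C}\setminus\{0\}$. 4. $\left[\begin{pmatrix}0&0\\\star&0\end{pmatrix};\begin{pmatrix}0&0\\0&0\end{pmatrix}\right]$: $k(x)=q^2x$, $k(y)=q^{-1}y$, $e(x)=-qc_0^{-1}x^2$, $e(y)=c_0^{-1}xy$, $f(x)=c_0$, $f(y)=0$, with $c_0\in\mathbb{C}\setminus\{0\}$. 5. $\left[\begin{pmatrix}\star&0\\0&0\end{pmatrix};\begin{pmatrix}0&0\\0&0\end{pmatrix}\right]$: $k(x)=q^{-2}x$, $k(y)=q^{-1}y$, $e(x)=a_0$, $e(y)=0$, $f(x)=-qa_0^{-1}x^2+ty^4$, $f(y)=-qa_0^{-1}xy+sy^3$, with $a_0\in\mathbb{C}\setminus\{0\}$, $s,t\in\mathbb{C}$. 6. $\left[\begin{pmatrix}0&0\\0&\star\end{pmatrix};\begin{pmatrix}0&0\\0&0\end{pmatrix}\right]$: $k(x)=qx$, $k(y)=q^2y$, $e(x)=-qd_0^{-1}xy+sx^3$,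 $e(y)=-qd_0^{-1}y^2+tx^4$, $f(x)=0$, $f(y)=d_0$, with $d_0\in\mathbb{C}\setminus\{0\}$, $s,t\in\mathbb{C}$. Then: (a) every $U_q(\mathfrak{sl}_2)$-module algebra structure on $\mathbb{C}_q[x,y]$ belongs to one of these six series; (b) each of the six series is nonempty and consists exactly of the structures given by the formulas next to it: a structure is in the series if and only if it satisfies these formulas for some admissible values of the parameters, and for each admissible choice of the parameters (or signs) exactly one structure satisfies the formulas; (c) for every other pair $(S_0,S_1)$ of symbolic matrices the $[S_0;S_1]$-series is empty; (d) structures that belong to different series are never isomorphic. -/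

import Mathlib

open scoped TensorProduct Polynomial

/-! ## The quantum universal enveloping algebra of `sl_2` -/

/-- The Chevalley generators of `U_q(sl_2)`. -/
inductive UqGen : Type
  | k | kinv | e | f

/-- The defining relations of `U_q(sl_2)`, in the free algebra on the generators. -/
inductive UqRel (q : ℂˣ) : FreeAlgebra ℂ UqGen → FreeAlgebra ℂ UqGen → Prop
  | kinv_k : UqRel q (FreeAlgebra.ι ℂ .kinv * FreeAlgebra.ι ℂ .k) 1
  | k_kinv : UqRel q (FreeAlgebra.ι ℂ .k * FreeAlgebra.ι ℂ .kinv) 1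
  | k_e : UqRel q (FreeAlgebra.ι ℂ .k * FreeAlgebra.ι ℂ .e)
      (((q : ℂ) ^ 2) • (FreeAlgebra.ι ℂ .e * FreeAlgebra.ι ℂ .k))
  | k_f : UqRel q (FreeAlgebra.ι ℂ .k * FreeAlgebra.ι ℂ .f)
      (((q : ℂ) ^ (-2 : ℤ)) • (FreeAlgebra.ι ℂ .f * FreeAlgebra.ι ℂ .k))
  | e_f : UqRel q
      (FreeAlgebra.ι ℂ .e * FreeAlgebra.ι ℂ .f - FreeAlgebra.ι ℂ .f * FreeAlgebra.ι ℂ .e)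
      (((q : ℂ) - (q : ℂ)⁻¹)⁻¹ • (FreeAlgebra.ι ℂ .k - FreeAlgebra.ι ℂ .kinv))

/-- The algebra `U_q(sl_2)` over `ℂ`, by generators and relations. -/
def Uq (q : ℂˣ) : Type := RingQuot (UqRel q)

namespace Uq

noncomputable instance instRing (q : ℂˣ) : Ring (Uq q) :=
  inferInstanceAs (Ring (RingQuot (UqRel q)))

noncomputable instance instAlgebra (q : ℂˣ) : Algebra ℂ (Uq q) :=
  inferInstanceAs (Algebra ℂ (RingQuot (UqRel q)))

/-- The image in `U_q(sl_2)` of a generator. -/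
noncomputable def gen (q : ℂˣ) (g : UqGen) : Uq q :=
  RingQuot.mkAlgHom ℂ (UqRel q) (FreeAlgebra.ι ℂ g)

variable {q : ℂˣ}

theorem kinv_mul_k : gen q .kinv * gen q .k = 1 := by
  have h := RingQuot.mkAlgHom_rel ℂ (UqRel.kinv_k (q := q))
  rw [map_mul, map_one] at h
  exact h

theorem k_mul_kinv : gen q .k * gen q .kinv = 1 := by
  have h := RingQuot.mkAlgHom_rel ℂ (UqRel.k_kinv (q := q))
  rw [map_mul, map_one] at h
  exact h

theorem k_mul_e : gen q .k * gen q .e = ((q : ℂ) ^ 2) • (gen q .e * gen q .k) := by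
  have h := RingQuot.mkAlgHom_rel ℂ (UqRel.k_e (q := q))
  rw [map_mul, map_smul, map_mul] at h
  exact h

theorem k_mul_f : gen q .k * gen q .f = ((q : ℂ) ^ (-2 : ℤ)) • (gen q .f * gen q .k) := by
  have h := RingQuot.mkAlgHom_rel ℂ (UqRel.k_f (q := q))
  rw [map_mul, map_smul, map_mul] at h
  exact h

theorem e_mul_f_sub : gen q .e * gen q .f - gen q .f * gen q .e =
    ((q : ℂ) - (q : ℂ)⁻¹)⁻¹ • (gen q .k - gen q .kinv) := by
  have h := RingQuot.mkAlgHom_rel ℂ (UqRel.e_f (q := q))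
  rw [map_sub, map_smul, map_mul, map_mul, map_sub] at h
  exact h

/-- The universal property of `U_q(sl_2)`: images of the generators that satisfy the defining
relations determine an algebra homomorphism. -/
noncomputable def lift {B : Type*} [Ring B] [Algebra ℂ B] (φ : UqGen → B)
    (h1 : φ .kinv * φ .k = 1) (h2 : φ .k * φ .kinv = 1)
    (h3 : φ .k * φ .e = ((q : ℂ) ^ 2) • (φ .e * φ .k))
    (h4 : φ .k * φ .f = ((q : ℂ) ^ (-2 : ℤ)) • (φ .f * φ .k))
    (h5 : φ .e * φ .f - φ .f * φ .e = ((q : ℂ) - (q : ℂ)⁻¹)⁻¹ • (φ .k - φ .kinv)) :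
    Uq q →ₐ[ℂ] B :=
  RingQuot.liftAlgHom ℂ ⟨FreeAlgebra.lift ℂ φ, by
    intro x y h
    cases h with
    | kinv_k => simpa using h1
    | k_kinv => simpa using h2
    | k_e => rw [map_mul, map_smul, map_mul]; simpa only [FreeAlgebra.lift_ι_apply] using h3
    | k_f => rw [map_mul, map_smul, map_mul]; simpa only [FreeAlgebra.lift_ι_apply] using h4
    | e_f =>
      rw [map_sub, map_smul, map_mul, map_mul, map_sub]
      simpa only [FreeAlgebra.lift_ι_apply] using h5⟩

@[simp]
theorem lift_gen {B : Type*} [Ring B] [Algebra ℂ B] (φ : UqGen → B) (h1 h2 h3 h4 h5) (g : UqGen) :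
    lift (q := q) φ h1 h2 h3 h4 h5 (gen q g) = φ g := by
  unfold lift gen
  erw [RingQuot.liftAlgHom_mkAlgHom_apply]
  simp

theorem algHom_ext {B : Type*} [Semiring B] [Algebra ℂ B] {φ ψ : Uq q →ₐ[ℂ] B}
    (h : ∀ g, φ (gen q g) = ψ (gen q g)) : φ = ψ := by
  apply RingQuot.ringQuot_ext' (S := ℂ)
  apply FreeAlgebra.hom_ext
  funext g
  exact h g

/-- Every property that holds for scalars and generators and is stable under sums and products
holds on all of `U_q(sl_2)`. -/
theorem induction {P : Uq q → Prop} (hs : ∀ c : ℂ, P (algebraMap ℂ (Uq q) c))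
    (hg : ∀ g, P (gen q g)) (hmul : ∀ a b, P a → P b → P (a * b))
    (hadd : ∀ a b, P a → P b → P (a + b)) (u : Uq q) : P u := by
  obtain ⟨w, rfl⟩ := RingQuot.mkAlgHom_surjective ℂ (UqRel q) u
  induction w using FreeAlgebra.induction with
  | grade0 c => rw [AlgHom.commutes]; exact hs c
  | grade1 g => exact hg g
  | mul a b ha hb => rw [map_mul]; exact hmul _ _ ha hb
  | add a b ha hb => rw [map_add]; exact hadd _ _ ha hb

theorem kinv_mul_e : gen q .kinv * gen q .e = ((q : ℂ) ^ (-2 : ℤ)) • (gen q .e * gen q .kinv) := by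
  have h : gen q .kinv * (gen q .k * gen q .e) * gen q .kinv =
      ((q : ℂ) ^ 2) • (gen q .kinv * gen q .e) := by
    rw [k_mul_e]
    simp only [mul_smul_comm, smul_mul_assoc, mul_assoc, k_mul_kinv, mul_one]
  rw [← mul_assoc, kinv_mul_k, one_mul] at h
  rw [h, smul_smul, zpow_neg, zpow_ofNat, inv_mul_cancel₀ (pow_ne_zero _ q.ne_zero), one_smul]

theorem f_mul_k : gen q .f * gen q .k = ((q : ℂ) ^ 2) • (gen q .k * gen q .f) := by
  rw [k_mul_f, smul_smul, zpow_neg, zpow_ofNat, mul_inv_cancel₀ (pow_ne_zero _ q.ne_zero),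
    one_smul]

theorem kinv_mul_f : gen q .kinv * gen q .f = ((q : ℂ) ^ 2) • (gen q .f * gen q .kinv) := by
  have h : gen q .kinv * (gen q .f * gen q .k) * gen q .kinv =
      ((q : ℂ) ^ 2) • (gen q .f * gen q .kinv) := by
    rw [f_mul_k, mul_smul_comm, ← mul_assoc, kinv_mul_k, one_mul, smul_mul_assoc]
  rw [mul_assoc, mul_assoc, k_mul_kinv, mul_one] at h
  exact h

/-- The values of the comultiplication on the generators. -/
noncomputable def comulGen (q : ℂˣ) : UqGen → Uq q ⊗[ℂ] Uq q
  | .k => gen q .k ⊗ₜ gen q .k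
  | .kinv => gen q .kinv ⊗ₜ gen q .kinv
  | .e => 1 ⊗ₜ gen q .e + gen q .e ⊗ₜ gen q .k
  | .f => gen q .f ⊗ₜ 1 + gen q .kinv ⊗ₜ gen q .f

/-- The comultiplication of `U_q(sl_2)`. -/
noncomputable def comulHom (q : ℂˣ) : Uq q →ₐ[ℂ] Uq q ⊗[ℂ] Uq q :=
  lift (comulGen q)
    (by simp [comulGen, kinv_mul_k, Algebra.TensorProduct.one_def])
    (by simp [comulGen, k_mul_kinv, Algebra.TensorProduct.one_def])
    (by simp [comulGen, mul_add, add_mul, k_mul_e, TensorProduct.smul_tmul'])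
    (by simp [comulGen, mul_add, add_mul, k_mul_f, k_mul_kinv, kinv_mul_k,
          TensorProduct.smul_tmul'])
    (by
      have h1 : gen q .e * gen q .f = gen q .f * gen q .e +
          ((q : ℂ) - (q : ℂ)⁻¹)⁻¹ • (gen q .k - gen q .kinv) := by
        rw [← e_mul_f_sub]; abel
      have h2 : (gen q .kinv * gen q .e) ⊗ₜ[ℂ] (gen q .f * gen q .k) =
          (gen q .e * gen q .kinv) ⊗ₜ[ℂ] (gen q .k * gen q .f) := by
        rw [kinv_mul_e, f_mul_k, TensorProduct.smul_tmul, smul_smul, zpow_neg, zpow_ofNat,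
          inv_mul_cancel₀ (pow_ne_zero _ q.ne_zero), one_smul]
      simp only [comulGen, mul_add, add_mul, Algebra.TensorProduct.tmul_mul_tmul, one_mul, mul_one,
        h1, h2, TensorProduct.add_tmul, TensorProduct.tmul_add, TensorProduct.smul_tmul',
        TensorProduct.tmul_smul, TensorProduct.sub_tmul, TensorProduct.tmul_sub, smul_sub]
      abel)

/-- The values of the counit on the generators. -/
def counitGen : UqGen → ℂ
  | .k => 1
  | .kinv => 1
  | .e => 0
  | .f => 0

/-- The counit of `U_q(sl_2)`. -/
noncomputable def counitHom (q : ℂˣ) : Uq q →ₐ[ℂ] ℂ :=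
  lift counitGen (by simp [counitGen]) (by simp [counitGen]) (by simp [counitGen])
    (by simp [counitGen]) (by simp [counitGen])

noncomputable instance instBialgebra (q : ℂˣ) : Bialgebra ℂ (Uq q) :=
  Bialgebra.ofAlgHom (comulHom q) (counitHom q)
    (by
      apply algHom_ext
      rintro (_ | _ | _ | _) <;>
        simp [comulHom, comulGen, TensorProduct.add_tmul, TensorProduct.tmul_add,
          Algebra.TensorProduct.one_def, add_assoc])
    (by
      apply algHom_ext
      rintro (_ | _ | _ | _) <;>
        simp [comulHom, comulGen, counitHom, counitGen])
    (by
      apply algHom_ext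
      rintro (_ | _ | _ | _) <;>
        simp [comulHom, comulGen, counitHom, counitGen])

/-- The values of the antipode on the generators. -/
noncomputable def antipodeGen (q : ℂˣ) : UqGen → (Uq q)ᵐᵒᵖ
  | .k => .op (gen q .kinv)
  | .kinv => .op (gen q .k)
  | .e => .op (-(gen q .e * gen q .kinv))
  | .f => .op (-(gen q .k * gen q .f))

/-- The antipode of `U_q(sl_2)`, as a homomorphism to the opposite algebra. -/
noncomputable def antipodeHom (q : ℂˣ) : Uq q →ₐ[ℂ] (Uq q)ᵐᵒᵖ :=
  lift (antipodeGen q)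
    (by simp only [antipodeGen, ← MulOpposite.op_mul, kinv_mul_k, MulOpposite.op_one])
    (by simp only [antipodeGen, ← MulOpposite.op_mul, k_mul_kinv, MulOpposite.op_one])
    (by
      simp only [antipodeGen, ← MulOpposite.op_mul, ← MulOpposite.op_smul]
      congr 1
      rw [mul_neg, ← mul_assoc, kinv_mul_e, neg_mul, smul_neg, smul_mul_assoc, smul_smul, zpow_neg,
        zpow_ofNat, mul_inv_cancel₀ (pow_ne_zero _ q.ne_zero), one_smul])
    (by
      simp only [antipodeGen, ← MulOpposite.op_mul, ← MulOpposite.op_smul]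
      congr 1
      rw [k_mul_f, neg_mul, mul_neg, smul_mul_assoc, mul_smul_comm, mul_assoc, k_mul_kinv, mul_one,
        ← mul_assoc, kinv_mul_f, smul_mul_assoc, mul_assoc, kinv_mul_k, mul_one, smul_smul, zpow_neg,
        zpow_ofNat, inv_mul_cancel₀ (pow_ne_zero _ q.ne_zero), one_smul, smul_neg])
    (by
      simp only [antipodeGen, ← MulOpposite.op_mul, ← MulOpposite.op_smul, ← MulOpposite.op_sub]
      congr 1
      have h : gen q .k * gen q .f * (gen q .e * gen q .kinv) = gen q .f * gen q .e := by
        rw [k_mul_f, smul_mul_assoc, mul_assoc, ← mul_assoc (gen q .k), k_mul_e, smul_mul_assoc,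
          mul_assoc, k_mul_kinv, mul_one, mul_smul_comm, smul_smul, zpow_neg, zpow_ofNat,
          inv_mul_cancel₀ (pow_ne_zero _ q.ne_zero), one_smul]
      have h' : gen q .e * gen q .kinv * (gen q .k * gen q .f) = gen q .e * gen q .f := by
        rw [mul_assoc, ← mul_assoc (gen q .kinv), kinv_mul_k, one_mul]
      rw [neg_mul_neg, neg_mul_neg, h, h', ← neg_sub, e_mul_f_sub, ← smul_neg, neg_sub])

/-- The antipode of `U_q(sl_2)`. -/
noncomputable def antipodeLin (q : ℂˣ) : Uq q →ₗ[ℂ] Uq q :=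
  (MulOpposite.opLinearEquiv ℂ).symm.toLinearMap ∘ₗ (antipodeHom q).toLinearMap

theorem antipodeLin_mul (a b : Uq q) :
    antipodeLin q (a * b) = antipodeLin q b * antipodeLin q a := by
  simp [antipodeLin]

theorem antipodeLin_one : antipodeLin q 1 = 1 := by
  simp [antipodeLin]

theorem antipodeLin_gen (g : UqGen) :
    antipodeLin q (gen q g) = (antipodeGen q g).unop := by
  simp [antipodeLin, antipodeHom]

theorem comul_gen (g : UqGen) : Coalgebra.comul (R := ℂ) (gen q g) = comulGen q g :=
  lift_gen _ _ _ _ _ _ g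

theorem counit_gen (g : UqGen) : Coalgebra.counit (R := ℂ) (gen q g) = counitGen g :=
  lift_gen _ _ _ _ _ _ g

theorem antipode_left (u : Uq q) :
    LinearMap.mul' ℂ (Uq q) ((antipodeLin q).rTensor (Uq q) (Coalgebra.comul u)) =
      algebraMap ℂ (Uq q) (Coalgebra.counit u) := by
  have key : ∀ (s : Uq q ⊗[ℂ] Uq q) (x y : Uq q),
      LinearMap.mul' ℂ (Uq q) ((antipodeLin q).rTensor (Uq q) (s * x ⊗ₜ y)) =
        antipodeLin q x * LinearMap.mul' ℂ (Uq q) ((antipodeLin q).rTensor (Uq q) s) * y := by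
    intro s x y
    induction s with
    | zero => simp
    | tmul a b => simp [antipodeLin_mul, mul_assoc]
    | add a b ha hb => rw [add_mul, map_add, map_add, ha, hb, map_add, map_add, mul_add, add_mul]
  induction u using induction with
  | hs c => simp [antipodeLin, Algebra.TensorProduct.algebraMap_apply]
  | hg g =>
    rw [comul_gen, counit_gen]
    cases g <;> simp [comulGen, counitGen, antipodeLin_gen, antipodeGen, kinv_mul_k, k_mul_kinv]
    all_goals simp [antipodeLin_one, mul_assoc, kinv_mul_k]
  | hmul a b ha hb =>
    have h2 : ∀ t : Uq q ⊗[ℂ] Uq q,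
        LinearMap.mul' ℂ (Uq q) ((antipodeLin q).rTensor (Uq q) (Coalgebra.comul a * t)) =
        algebraMap ℂ (Uq q) (Coalgebra.counit a) *
          LinearMap.mul' ℂ (Uq q) ((antipodeLin q).rTensor (Uq q) t) := by
      intro t
      induction t with
      | zero => simp
      | tmul x y =>
        rw [key, ha, ← Algebra.commutes, mul_assoc]
        simp
      | add x y hx hy => rw [mul_add, map_add, map_add, hx, hy, map_add, map_add, mul_add]
    rw [Bialgebra.comul_mul, h2, hb, Bialgebra.counit_mul, map_mul]
  | hadd a b ha hb => simp only [map_add, ha, hb]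

theorem antipode_right (u : Uq q) :
    LinearMap.mul' ℂ (Uq q) ((antipodeLin q).lTensor (Uq q) (Coalgebra.comul u)) =
      algebraMap ℂ (Uq q) (Coalgebra.counit u) := by
  have key : ∀ (t : Uq q ⊗[ℂ] Uq q) (x y : Uq q),
      LinearMap.mul' ℂ (Uq q) ((antipodeLin q).lTensor (Uq q) (x ⊗ₜ y * t)) =
        x * LinearMap.mul' ℂ (Uq q) ((antipodeLin q).lTensor (Uq q) t) * antipodeLin q y := by
    intro t x y
    induction t with
    | zero => simp
    | tmul a b => simp [antipodeLin_mul, mul_assoc]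
    | add a b ha hb => rw [mul_add, map_add, map_add, ha, hb, map_add, map_add, mul_add, add_mul]
  induction u using induction with
  | hs c => simp [antipodeLin, Algebra.TensorProduct.algebraMap_apply]
  | hg g =>
    rw [comul_gen, counit_gen]
    cases g <;> simp [comulGen, counitGen, antipodeLin_gen, antipodeGen, kinv_mul_k, k_mul_kinv]
    all_goals simp [antipodeLin_one, ← mul_assoc (gen q .kinv), kinv_mul_k]
  | hmul a b ha hb =>
    have h2 : ∀ s : Uq q ⊗[ℂ] Uq q,
        LinearMap.mul' ℂ (Uq q) ((antipodeLin q).lTensor (Uq q) (s * Coalgebra.comul b)) =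
        LinearMap.mul' ℂ (Uq q) ((antipodeLin q).lTensor (Uq q) s) *
          algebraMap ℂ (Uq q) (Coalgebra.counit b) := by
      intro s
      induction s with
      | zero => simp
      | tmul x y =>
        rw [key, hb, mul_assoc, Algebra.commutes, ← mul_assoc]
        simp
      | add x y hx hy => rw [add_mul, map_add, map_add, hx, hy, map_add, map_add, add_mul]
    rw [Bialgebra.comul_mul, h2, ha, Bialgebra.counit_mul, map_mul]
  | hadd a b ha hb => simp only [map_add, ha, hb]

/-- The Hopf algebra `U_q(sl_2)`. -/
noncomputable instance instHopfAlgebra (q : ℂˣ) : HopfAlgebra ℂ (Uq q) where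
  antipode := antipodeLin q
  mul_antipode_rTensor_comul := LinearMap.ext antipode_left
  mul_antipode_lTensor_comul := LinearMap.ext antipode_right

end Uq

/-! ## Module algebra structures -/

/-- A structure of `H`-module algebra on `A`: an algebra homomorphism `π : H → End A` with
`π(h)(ab) = ∑ π(h')(a) π(h'')(b)` and `π(h)(1) = ε(h) 1`. -/
structure ModuleAlgebraStructure (R H A : Type*) [CommRing R] [Ring H] [HopfAlgebra R H]
    [Ring A] [Algebra R A] where
  /-- The underlying homomorphism `H → End A`. -/
  toHom : H →ₐ[R] Module.End R A
  map_mul' : ∀ (h : H) (a b : A), toHom h (a * b) =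
    LinearMap.mul' R A (TensorProduct.map (toHom.toLinearMap.flip a) (toHom.toLinearMap.flip b)
      (Coalgebra.comul (R := R) h))
  map_one' : ∀ h : H, toHom h 1 = Coalgebra.counit (R := R) h • (1 : A)

/-- Two structures are isomorphic if `Ψ π₁(h) Ψ⁻¹ = π₂(h)` for all `h`, for some automorphism `Ψ`
of the algebra `A`. -/
def ModuleAlgebraStructure.Isomorphic {R H A : Type*} [CommRing R] [Ring H] [HopfAlgebra R H]
    [Ring A] [Algebra R A] (π₁ π₂ : ModuleAlgebraStructure R H A) : Prop :=
  ∃ Ψ : A ≃ₐ[R] A, ∀ (h : H) (a : A), Ψ (π₁.toHom h (Ψ.symm a)) = π₂.toHom h a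

/-! ## The quantum plane -/

/-- The generators of the quantum plane. -/
inductive QPlaneGen : Type
  | x | y

/-- The defining relation `yx = qxy` of the quantum plane. -/
inductive QPlaneRel (q : ℂˣ) : FreeAlgebra ℂ QPlaneGen → FreeAlgebra ℂ QPlaneGen → Prop
  | y_x : QPlaneRel q (FreeAlgebra.ι ℂ .y * FreeAlgebra.ι ℂ .x)
      ((q : ℂ) • (FreeAlgebra.ι ℂ .x * FreeAlgebra.ι ℂ .y))

/-- The quantum plane `ℂ_q[x, y]`. -/
def QPlane (q : ℂˣ) : Type := RingQuot (QPlaneRel q)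

namespace QPlane

noncomputable instance instRing (q : ℂˣ) : Ring (QPlane q) :=
  inferInstanceAs (Ring (RingQuot (QPlaneRel q)))

noncomputable instance instAlgebra (q : ℂˣ) : Algebra ℂ (QPlane q) :=
  inferInstanceAs (Algebra ℂ (RingQuot (QPlaneRel q)))

/-- The quotient homomorphism from the free algebra. -/
noncomputable def mk (q : ℂˣ) : FreeAlgebra ℂ QPlaneGen →ₐ[ℂ] QPlane q :=
  RingQuot.mkAlgHom ℂ (QPlaneRel q)

/-- The generator `x` of the quantum plane. -/
noncomputable def x (q : ℂˣ) : QPlane q :=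
  mk q (FreeAlgebra.ι ℂ .x)

/-- The generator `y` of the quantum plane. -/
noncomputable def y (q : ℂˣ) : QPlane q :=
  mk q (FreeAlgebra.ι ℂ .y)

variable {q : ℂˣ}

theorem y_mul_x : y q * x q = (q : ℂ) • (x q * y q) := by
  have h := RingQuot.mkAlgHom_rel ℂ (QPlaneRel.y_x (q := q))
  rw [map_mul, map_smul, map_mul] at h
  exact h

/-- The universal property of the quantum plane. -/
noncomputable def lift {B : Type*} [Ring B] [Algebra ℂ B] (a b : B)
    (h : b * a = (q : ℂ) • (a * b)) : QPlane q →ₐ[ℂ] B :=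
  RingQuot.liftAlgHom ℂ ⟨FreeAlgebra.lift ℂ (fun | .x => a | .y => b), by
    intro u v huv
    cases huv
    rw [map_mul, map_smul, map_mul]
    simpa only [FreeAlgebra.lift_ι_apply] using h⟩

@[simp]
theorem lift_x {B : Type*} [Ring B] [Algebra ℂ B] (a b : B) (h : b * a = (q : ℂ) • (a * b)) :
    lift a b h (x q) = a := by
  unfold lift x mk
  erw [RingQuot.liftAlgHom_mkAlgHom_apply]
  simp

@[simp]
theorem lift_y {B : Type*} [Ring B] [Algebra ℂ B] (a b : B) (h : b * a = (q : ℂ) • (a * b)) :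
    lift a b h (y q) = b := by
  unfold lift y mk
  erw [RingQuot.liftAlgHom_mkAlgHom_apply]
  simp

/-- The monomials `x ^ m * y ^ n` span the quantum plane. -/
theorem span_monomials :
    Submodule.span ℂ (Set.range fun i : ℕ × ℕ => x q ^ i.1 * y q ^ i.2) = ⊤ := by
  have hyx : ∀ n : ℕ, y q ^ n * x q = ((q : ℂ) ^ n) • (x q * y q ^ n) := by
    intro n
    induction n with
    | zero => simp
    | succ n ih =>
      rw [pow_succ', mul_assoc, ih, mul_smul_comm, ← mul_assoc, y_mul_x, smul_mul_assoc, smul_smul,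
        mul_assoc, pow_succ]
  set S := Submodule.span ℂ (Set.range fun i : ℕ × ℕ => x q ^ i.1 * y q ^ i.2) with hS
  have mono : ∀ m n : ℕ, x q ^ m * y q ^ n ∈ S := fun m n =>
    Submodule.subset_span ⟨(m, n), rfl⟩
  have hx : ∀ u ∈ S, u * x q ∈ S := by
    intro u hu
    induction hu using Submodule.span_induction with
    | mem u hu =>
      obtain ⟨⟨m, n⟩, rfl⟩ := hu
      change x q ^ m * y q ^ n * x q ∈ S
      rw [mul_assoc, hyx, mul_smul_comm, ← mul_assoc, ← pow_succ]
      exact S.smul_mem _ (mono _ _)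
    | zero => simp
    | add u v _ _ h1 h2 => rw [add_mul]; exact S.add_mem h1 h2
    | smul c u _ h => rw [smul_mul_assoc]; exact S.smul_mem _ h
  have hy : ∀ u ∈ S, u * y q ∈ S := by
    intro u hu
    induction hu using Submodule.span_induction with
    | mem u hu =>
      obtain ⟨⟨m, n⟩, rfl⟩ := hu
      change x q ^ m * y q ^ n * y q ∈ S
      rw [mul_assoc, ← pow_succ]
      exact mono _ _
    | zero => simp
    | add u v _ _ h1 h2 => rw [add_mul]; exact S.add_mem h1 h2
    | smul c u _ h => rw [smul_mul_assoc]; exact S.smul_mem _ h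
  have main : ∀ w : FreeAlgebra ℂ QPlaneGen, ∀ u ∈ S,
      u * mk q w ∈ S := by
    intro w
    induction w using FreeAlgebra.induction with
    | grade0 c =>
      intro u hu
      rw [AlgHom.commutes]
      rw [← Algebra.commutes, ← Algebra.smul_def]
      exact S.smul_mem _ hu
    | grade1 g =>
      cases g
      · exact hx
      · exact hy
    | mul a b ha hb =>
      intro u hu
      rw [map_mul, ← mul_assoc]
      exact hb _ (ha u hu)
    | add a b ha hb =>
      intro u hu
      rw [map_add, mul_add]
      exact S.add_mem (ha u hu) (hb u hu)
  rw [eq_top_iff]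
  intro u _
  obtain ⟨w, rfl⟩ := RingQuot.mkAlgHom_surjective ℂ (QPlaneRel q) u
  have h1 : (1 : QPlane q) ∈ S := by simpa using mono 0 0
  have := main w 1 h1
  rw [one_mul] at this
  exact this

/-- The algebra homomorphism `ℂ_q[x, y] → ℂ_q[x, y][T]` with `x ↦ x T` and `y ↦ y T`, where `T` is
a central variable that records the degree. -/
noncomputable def gradeHom (q : ℂˣ) : QPlane q →ₐ[ℂ] (QPlane q)[X] :=
  lift (Polynomial.monomial 1 (x q)) (Polynomial.monomial 1 (y q))
    (by rw [Polynomial.monomial_mul_monomial, Polynomial.monomial_mul_monomial, y_mul_x,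
      Polynomial.smul_monomial])

/-- The projection `p ↦ (p)_i` onto the `i`-th homogeneous component, which is the span of the
`x ^ m * y ^ n` with `m + n = i`, parallel to the other homogeneous components. -/
noncomputable def homogComp (q : ℂˣ) (i : ℕ) : QPlane q →ₗ[ℂ] QPlane q where
  toFun p := (gradeHom q p).coeff i
  map_add' _ _ := by rw [map_add, Polynomial.coeff_add]
  map_smul' _ _ := by rw [map_smul, Polynomial.coeff_smul, RingHom.id_apply]

/-- Together with `span_monomials`, this characterizes `homogComp`. -/
theorem homogComp_monomial (i m n : ℕ) :
    homogComp q i (x q ^ m * y q ^ n) = if m + n = i then x q ^ m * y q ^ n else 0 := by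
  simp only [homogComp, LinearMap.coe_mk, AddHom.coe_mk, gradeHom, map_mul, map_pow, lift_x, lift_y,
    Polynomial.monomial_pow, Polynomial.monomial_mul_monomial, Polynomial.coeff_monomial, one_mul]

end QPlane

/-! ## Action matrices, symbolic matrices and series -/

/-- The structures of `U_q(sl_2)`-module algebra on the quantum plane. -/
abbrev QPlaneAction (q : ℂˣ) : Type := ModuleAlgebraStructure ℂ (Uq q) (QPlane q)

/-- The symbols `0` and `⋆`. -/
inductive Symb : Type
  | zero | star

/-- A symbolic matrix; its rows are indexed by `e, f` and its columns by `x, y`. -/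
abbrev SymbMatrix : Type := Matrix (Fin 2) (Fin 2) Symb

open Classical in
/-- The symbol of a polynomial: `0` if it is zero, and `⋆` otherwise. -/
noncomputable def Symb.of {q : ℂˣ} (p : QPlane q) : Symb :=
  if p = 0 then .zero else .star

namespace QPlaneAction

variable {q : ℂˣ}

/-- The full action matrix, with rows `k, e, f` and columns `x, y`. -/
noncomputable def fullMatrix (π : QPlaneAction q) : Matrix (Fin 3) (Fin 2) (QPlane q) :=
  !![π.toHom (Uq.gen q .k) (QPlane.x q), π.toHom (Uq.gen q .k) (QPlane.y q);
     π.toHom (Uq.gen q .e) (QPlane.x q), π.toHom (Uq.gen q .e) (QPlane.y q);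
     π.toHom (Uq.gen q .f) (QPlane.x q), π.toHom (Uq.gen q .f) (QPlane.y q)]

/-- The action `ef`-matrix, with rows `e, f` and columns `x, y`. -/
noncomputable def efMatrix (π : QPlaneAction q) : Matrix (Fin 2) (Fin 2) (QPlane q) :=
  !![π.toHom (Uq.gen q .e) (QPlane.x q), π.toHom (Uq.gen q .e) (QPlane.y q);
     π.toHom (Uq.gen q .f) (QPlane.x q), π.toHom (Uq.gen q .f) (QPlane.y q)]

/-- The symbolic matrix of the `i`-th homogeneous component of the action `ef`-matrix. -/
noncomputable def symbMatrix (π : QPlaneAction q) (i : ℕ) : SymbMatrix :=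
  π.efMatrix.map fun p => Symb.of (QPlane.homogComp q i p)

/-- The `[S₀; S₁]`-series: all structures whose `ef`-matrix has the symbolic matrix `S₀` in
degree `0` and `S₁` in degree `1`. -/
def series (q : ℂˣ) (S₀ S₁ : SymbMatrix) : Set (QPlaneAction q) :=
  {π | π.symbMatrix 0 = S₀ ∧ π.symbMatrix 1 = S₁}

end QPlaneAction

/-- Names for the six listed series. The names `ex`, `ey`, `fx`, `fy` say which entry of the
`ef`-matrix has a nonzero constant term. -/
inductive ListedSeries : Type
  | trivial | standard | ey | fx | ex | fy

namespace ListedSeries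

/-- The symbolic matrix in degree `0` that labels a listed series. -/
def symb0 : ListedSeries → SymbMatrix
  | trivial => !![.zero, .zero; .zero, .zero]
  | standard => !![.zero, .zero; .zero, .zero]
  | ey => !![.zero, .star; .zero, .zero]
  | fx => !![.zero, .zero; .star, .zero]
  | ex => !![.star, .zero; .zero, .zero]
  | fy => !![.zero, .zero; .zero, .star]

/-- The symbolic matrix in degree `1` that labels a listed series. -/
def symb1 : ListedSeries → SymbMatrix
  | standard => !![.zero, .star; .star, .zero]
  | _ => !![.zero, .zero; .zero, .zero]

/-- The full action matrices (rows `k, e, f`, columns `x, y`) of the structures listed for a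
series. -/
def fullMatrices (q : ℂˣ) : ListedSeries → Set (Matrix (Fin 3) (Fin 2) (QPlane q))
  | trivial => {M | ∃ α β : ℂ, (α = 1 ∨ α = -1) ∧ (β = 1 ∨ β = -1) ∧
      M = !![α • QPlane.x q, β • QPlane.y q;
             0, 0;
             0, 0]}
  | standard => {M | ∃ τ : ℂ, τ ≠ 0 ∧
      M = !![(q : ℂ) • QPlane.x q, (q : ℂ)⁻¹ • QPlane.y q;
             0, τ • QPlane.x q;
             τ⁻¹ • QPlane.y q, 0]}
  | ey => {M | ∃ b₀ : ℂ, b₀ ≠ 0 ∧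
      M = !![(q : ℂ) • QPlane.x q, ((q : ℂ) ^ 2)⁻¹ • QPlane.y q;
             0, b₀ • 1;
             b₀⁻¹ • (QPlane.x q * QPlane.y q), (-((q : ℂ) * b₀⁻¹)) • QPlane.y q ^ 2]}
  | fx => {M | ∃ c₀ : ℂ, c₀ ≠ 0 ∧
      M = !![((q : ℂ) ^ 2) • QPlane.x q, (q : ℂ)⁻¹ • QPlane.y q;
             (-((q : ℂ) * c₀⁻¹)) • QPlane.x q ^ 2, c₀⁻¹ • (QPlane.x q * QPlane.y q);
             c₀ • 1, 0]}
  | ex => {M | ∃ a₀ s t : ℂ, a₀ ≠ 0 ∧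
      M = !![((q : ℂ) ^ 2)⁻¹ • QPlane.x q, (q : ℂ)⁻¹ • QPlane.y q;
             a₀ • 1, 0;
             (-((q : ℂ) * a₀⁻¹)) • QPlane.x q ^ 2 + t • QPlane.y q ^ 4,
               (-((q : ℂ) * a₀⁻¹)) • (QPlane.x q * QPlane.y q) + s • QPlane.y q ^ 3]}
  | fy => {M | ∃ d₀ s t : ℂ, d₀ ≠ 0 ∧
      M = !![(q : ℂ) • QPlane.x q, ((q : ℂ) ^ 2) • QPlane.y q;
             (-((q : ℂ) * d₀⁻¹)) • (QPlane.x q * QPlane.y q) + s • QPlane.x q ^ 3,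
               (-((q : ℂ) * d₀⁻¹)) • QPlane.y q ^ 2 + t • QPlane.x q ^ 4;
             0, d₀ • 1]}

/-- The listed series as a set of structures. -/
def toSet (q : ℂˣ) (L : ListedSeries) : Set (QPlaneAction q) :=
  QPlaneAction.series q L.symb0 L.symb1

end ListedSeries

/-! Since `Δ(k) = k ⊗ k`, the generator `k` acts by an algebra automorphism. For `q` not a root of
unity every automorphism of the quantum plane is diagonal, `x ↦ αx`, `y ↦ βy` (`algEquiv_x_y`). The
operators `e` and `f` are skew derivations twisted by `k` and `k⁻¹`, so they are determined by their
values on `x` and `y`. A structure is thus a pair of weights and four polynomials, subject to the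
compatibility with `yx = qxy` and the relations of `U_q(sl_2)` tested on `x` and `y` (`SkewTriple`).

Two constraints act coefficientwise. A monomial by which `e` (or `f`) shifts exponents by `(m, n)`
needs `α^m β^n = q^2` (or `q^(-2)`), and compatibility with `yx = qxy` links the coefficients of the
values on `x` and `y` that have the same shift (`coeffs_rel`). A nonzero constant term has a shift
with an entry `-1`, so its partner is absent and both weights are determined. If there are no
constant terms, then `e` and `f` act on linear terms by 2 × 2 matrices, and their commutator leaves
only `α² = β² = 1` or `(α, β) = (q, q⁻¹)` (`weights_of_coeffs_zero`).

It remains to find the polynomials for given weights. If `α² = β² = 1`, no shift has weight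
`q^(±2)`, and the action of `e` and `f` vanishes. For `(q⁻², q⁻¹)` the weight equation has finitely
many solutions. For `(q, q^(-t))` it has infinitely many. There the leading part of a skew
derivation looks like an inner one, and the leading terms in `ef - fe = (k - k⁻¹)/(q - q⁻¹)` exclude
all shifts but one (`top_E_F`, `coeffs_of_weights`). The anti-automorphism that swaps `x` and `y`
exchanges `e` and `f` and yields the remaining cases.

Conversely, the listed values satisfy the finitely many conditions. Isomorphisms are diagonal as
well, so they preserve the vanishing of homogeneous components, which separates the series. -/

/-! ### Monomial basis, coefficients and leading terms in the quantum plane. -/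

namespace QPlane

variable {q : ℂˣ}

/-- Two linear maps that agree on the monomials are equal. -/
theorem linear_ext {M : Type*} [AddCommGroup M] [Module ℂ M] {f g : QPlane q →ₗ[ℂ] M}
    (h : ∀ m n : ℕ, f (x q ^ m * y q ^ n) = g (x q ^ m * y q ^ n)) : f = g :=
  LinearMap.ext_on_range span_monomials fun i => h i.1 i.2

theorem y_mul_x_pow (m : ℕ) : y q * x q ^ m = ((q : ℂ) ^ m) • (x q ^ m * y q) := by
  induction m with
  | zero => simp
  | succ m ih =>
    rw [pow_succ, ← mul_assoc, ih, smul_mul_assoc, mul_assoc, y_mul_x, mul_smul_comm, smul_smul,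
      ← pow_succ, mul_assoc]

theorem y_pow_mul_x (n : ℕ) : y q ^ n * x q = ((q : ℂ) ^ n) • (x q * y q ^ n) := by
  induction n with
  | zero => simp
  | succ n ih =>
    rw [pow_succ', mul_assoc, ih, mul_smul_comm, ← mul_assoc, y_mul_x, smul_mul_assoc, smul_smul,
      mul_assoc, pow_succ]

theorem y_pow_mul_x_pow (n m : ℕ) :
    y q ^ n * x q ^ m = ((q : ℂ) ^ (n * m)) • (x q ^ m * y q ^ n) := by
  induction m with
  | zero => simp
  | succ m ih =>
    rw [pow_succ, ← mul_assoc, ih, smul_mul_assoc, mul_assoc, y_pow_mul_x, mul_smul_comm,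
      smul_smul, ← pow_add, ← mul_assoc, mul_add, mul_one]

theorem monomial_mul_monomial (m n m' n' : ℕ) :
    (x q ^ m * y q ^ n) * (x q ^ m' * y q ^ n') =
      ((q : ℂ) ^ (n * m')) • (x q ^ (m + m') * y q ^ (n + n')) := by
  rw [mul_assoc, ← mul_assoc (y q ^ n), y_pow_mul_x_pow, smul_mul_assoc, mul_smul_comm, mul_assoc,
    ← pow_add, ← mul_assoc, ← pow_add]

/-- Left multiplication by `x` on the quantum torus. -/
noncomputable def torusX : Module.End ℂ (ℤ × ℤ →₀ ℂ) :=
  Finsupp.linearCombination ℂ fun g => Finsupp.single (g + (1, 0)) 1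

/-- Left multiplication by `y` on the quantum torus. -/
noncomputable def torusY (q : ℂˣ) : Module.End ℂ (ℤ × ℤ →₀ ℂ) :=
  Finsupp.linearCombination ℂ fun g => Finsupp.single (g + (0, 1)) ((q : ℂ) ^ g.1)

/-- The quantum plane acts on the quantum torus by left multiplication. -/
noncomputable def torusRep (q : ℂˣ) : QPlane q →ₐ[ℂ] Module.End ℂ (ℤ × ℤ →₀ ℂ) :=
  lift torusX (torusY q) (by
    ext g : 2
    simp [torusX, torusY, zpow_add₀ q.ne_zero, mul_comm, add_right_comm])

/-- The coefficients of a polynomial with respect to the monomials `x ^ m * y ^ n`, extended by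
zero to all integer exponents. -/
noncomputable def coeffs : QPlane q →ₗ[ℂ] (ℤ × ℤ →₀ ℂ) :=
  (torusRep q).toLinearMap.flip (Finsupp.single 0 1)

theorem coeffs_monomial (m n : ℕ) :
    coeffs (x q ^ m * y q ^ n) = Finsupp.single ((m : ℤ), (n : ℤ)) 1 := by
  have hy : ∀ n : ℕ, (torusY q ^ n) (Finsupp.single 0 1) = Finsupp.single (0, (n : ℤ)) 1 := by
    intro n
    induction n with
    | zero => rfl
    | succ n ih => rw [pow_succ', Module.End.mul_apply, ih]; simp [torusY]
  have hx : ∀ m : ℕ, (torusX ^ m) (Finsupp.single (0, (n : ℤ)) 1) =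
      Finsupp.single ((m : ℤ), (n : ℤ)) 1 := by
    intro m
    induction m with
    | zero => simp
    | succ m ih => rw [pow_succ', Module.End.mul_apply, ih]; simp [torusX]
  simp only [coeffs, LinearMap.flip_apply, AlgHom.toLinearMap_apply, map_mul, map_pow, torusRep,
    lift_x, lift_y, Module.End.mul_apply, hy, hx]

/-- The monomial with a given exponent (and a junk value for negative exponents). -/
noncomputable def mono (q : ℂˣ) (g : ℤ × ℤ) : QPlane q := x q ^ g.1.toNat * y q ^ g.2.toNat

theorem linearCombination_coeffs (p : QPlane q) :
    Finsupp.linearCombination ℂ (mono q) (coeffs p) = p := by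
  have : Finsupp.linearCombination ℂ (mono q) ∘ₗ coeffs = LinearMap.id :=
    linear_ext fun m n => by simp [coeffs_monomial, mono]
  exact LinearMap.congr_fun this p

theorem coeffs_injective : Function.Injective (coeffs (q := q)) :=
  Function.LeftInverse.injective linearCombination_coeffs

theorem sum_coeffs (p : QPlane q) : ∑ g ∈ (coeffs p).support, coeffs p g • mono q g = p := by
  conv_rhs => rw [← linearCombination_coeffs p, Finsupp.linearCombination_apply, Finsupp.sum]

theorem ext_coeffs {p p' : QPlane q} (h : ∀ i j : ℤ, coeffs p (i, j) = coeffs p' (i, j)) :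
    p = p' :=
  coeffs_injective (Finsupp.ext fun g => h g.1 g.2)

theorem coeffs_eq_zero {g : ℤ × ℤ} (hg : g.1 < 0 ∨ g.2 < 0) (p : QPlane q) : coeffs p g = 0 := by
  have : Finsupp.lapply (R := ℂ) g ∘ₗ coeffs (q := q) = 0 := linear_ext fun m n => by
    simp only [LinearMap.comp_apply, coeffs_monomial, Finsupp.lapply_apply, LinearMap.zero_apply]
    rw [Finsupp.single_apply, if_neg]
    rintro rfl
    simp at hg
    omega
  exact LinearMap.congr_fun this p

theorem nonneg_of_coeffs_ne_zero {p : QPlane q} {g : ℤ × ℤ} (h : coeffs p g ≠ 0) :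
    0 ≤ g.1 ∧ 0 ≤ g.2 := by
  by_contra hg
  exact h (coeffs_eq_zero (by omega) p)

theorem coeffs_mul (p p' : QPlane q) : coeffs (p * p') =
    (coeffs p).sum fun g c => (coeffs p').sum fun g' c' =>
      Finsupp.single (g + g') (c * c' * (q : ℂ) ^ (g.2 * g'.1)) := by
  -- `B` is the twisted product on exponents. Both sides are bilinear, so it suffices to compare
  -- them on monomials.
  let B : (ℤ × ℤ →₀ ℂ) →ₗ[ℂ] (ℤ × ℤ →₀ ℂ) →ₗ[ℂ] (ℤ × ℤ →₀ ℂ) :=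
    Finsupp.lsum ℂ fun g => LinearMap.toSpanSingleton ℂ _ (Finsupp.lsum ℂ fun g' =>
      LinearMap.toSpanSingleton ℂ _ (Finsupp.single (g + g') ((q : ℂ) ^ (g.2 * g'.1))))
  have h : (LinearMap.mul ℂ (QPlane q)).compr₂ coeffs = B.compl₁₂ coeffs coeffs :=
    linear_ext fun m n => linear_ext fun m' n' => by
      simp [B, monomial_mul_monomial, coeffs_monomial]
      norm_cast
  have h' := LinearMap.congr_fun₂ h p p'
  simp only [LinearMap.compr₂_apply, LinearMap.mul_apply', LinearMap.compl₁₂_apply] at h'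
  rw [h']
  simp only [B, Finsupp.lsum_apply, Finsupp.sum,
    LinearMap.sum_apply, LinearMap.smul_apply, LinearMap.toSpanSingleton_apply,
    Finsupp.smul_single, Finset.smul_sum, smul_eq_mul, mul_assoc]

theorem coeffs_mul_apply (p p' : QPlane q) (k : ℤ × ℤ) : coeffs (p * p') k =
    ∑ g ∈ (coeffs p).support, ∑ g' ∈ (coeffs p').support,
      if g + g' = k then coeffs p g * coeffs p' g' * (q : ℂ) ^ (g.2 * g'.1) else 0 := by
  simp only [coeffs_mul, Finsupp.sum, Finsupp.finsetSum_apply, Finsupp.single_apply]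

theorem coeffs_x : coeffs (x q) = Finsupp.single (1, 0) 1 := by
  simpa using coeffs_monomial (q := q) 1 0

theorem coeffs_y : coeffs (y q) = Finsupp.single (0, 1) 1 := by
  simpa using coeffs_monomial (q := q) 0 1

theorem coeffs_one : coeffs (1 : QPlane q) = Finsupp.single (0, 0) 1 := by
  simpa using coeffs_monomial (q := q) 0 0

/-- Integer exponents make the shift total: for `i = 0` both sides vanish, and no boundary case is
needed. The same holds for the three variants below. -/
theorem coeffs_x_mul (p : QPlane q) (i j : ℤ) :
    coeffs (x q * p) (i, j) = coeffs p (i - 1, j) := by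
  have : Finsupp.lapply (R := ℂ) (i, j) ∘ₗ coeffs ∘ₗ LinearMap.mulLeft ℂ (x q) =
      Finsupp.lapply (R := ℂ) (i - 1, j) ∘ₗ coeffs := linear_ext fun m n => by
    simp only [LinearMap.comp_apply, LinearMap.mulLeft_apply, Finsupp.lapply_apply, ← mul_assoc,
      ← pow_succ', coeffs_monomial, Finsupp.single_apply, Prod.mk.injEq]
    push_cast
    congr 2
    rw [eq_sub_iff_add_eq]
  exact LinearMap.congr_fun this p

theorem coeffs_mul_y (p : QPlane q) (i j : ℤ) :
    coeffs (p * y q) (i, j) = coeffs p (i, j - 1) := by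
  have : Finsupp.lapply (R := ℂ) (i, j) ∘ₗ coeffs ∘ₗ LinearMap.mulRight ℂ (y q) =
      Finsupp.lapply (R := ℂ) (i, j - 1) ∘ₗ coeffs := linear_ext fun m n => by
    simp only [LinearMap.comp_apply, LinearMap.mulRight_apply, Finsupp.lapply_apply, mul_assoc,
      ← pow_succ, coeffs_monomial, Finsupp.single_apply, Prod.mk.injEq]
    push_cast
    congr 2
    rw [eq_sub_iff_add_eq]
  exact LinearMap.congr_fun this p

theorem coeffs_y_mul (p : QPlane q) (i j : ℤ) :
    coeffs (y q * p) (i, j) = (q : ℂ) ^ i * coeffs p (i, j - 1) := by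
  have : Finsupp.lapply (R := ℂ) (i, j) ∘ₗ coeffs ∘ₗ LinearMap.mulLeft ℂ (y q) =
      ((q : ℂ) ^ i) • Finsupp.lapply (R := ℂ) (i, j - 1) ∘ₗ coeffs := linear_ext fun m n => by
    simp only [LinearMap.comp_apply, LinearMap.mulLeft_apply, Finsupp.lapply_apply, ← mul_assoc,
      y_mul_x_pow, smul_mul_assoc, map_smul, LinearMap.smul_apply, smul_eq_mul]
    simp only [mul_assoc, ← pow_succ', coeffs_monomial, Finsupp.single_apply, Prod.mk.injEq]
    push_cast
    by_cases h : (m : ℤ) = i ∧ (n : ℤ) + 1 = j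
    · obtain ⟨rfl, rfl⟩ := h
      simp
    · rw [if_neg h, if_neg (by omega), mul_zero, mul_zero]
  exact LinearMap.congr_fun this p

theorem coeffs_mul_x (p : QPlane q) (i j : ℤ) :
    coeffs (p * x q) (i, j) = (q : ℂ) ^ j * coeffs p (i - 1, j) := by
  have : Finsupp.lapply (R := ℂ) (i, j) ∘ₗ coeffs ∘ₗ LinearMap.mulRight ℂ (x q) =
      ((q : ℂ) ^ j) • Finsupp.lapply (R := ℂ) (i - 1, j) ∘ₗ coeffs := linear_ext fun m n => by
    simp only [LinearMap.comp_apply, LinearMap.mulRight_apply, Finsupp.lapply_apply, mul_assoc,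
      y_pow_mul_x, mul_smul_comm, map_smul, LinearMap.smul_apply, smul_eq_mul]
    simp only [← mul_assoc, ← pow_succ, coeffs_monomial, Finsupp.single_apply, Prod.mk.injEq]
    push_cast
    by_cases h : (m : ℤ) + 1 = i ∧ (n : ℤ) = j
    · obtain ⟨rfl, rfl⟩ := h
      simp
    · rw [if_neg h, if_neg (by omega), mul_zero, mul_zero]
  exact LinearMap.congr_fun this p

/-! ### Leading terms -/

/-- All exponents of `p` are at most `g` for the order on `ℤ × ℤ` pulled back along `φ`, and `c` is
the (possibly zero) coefficient of `p` at `g`. -/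
def TopAt (φ : ℤ × ℤ →+ ℝ) (g : ℤ × ℤ) (c : ℂ) (p : QPlane q) : Prop :=
  coeffs p g = c ∧ ∀ h, coeffs p h ≠ 0 → φ h ≤ φ g

namespace TopAt

variable {φ : ℤ × ℤ →+ ℝ} {g g' : ℤ × ℤ} {c c' : ℂ} {p p' : QPlane q}

theorem of_eq (h : TopAt φ g c p) (hg : g = g') (hc : c = c') : TopAt φ g' c' p :=
  hg ▸ hc ▸ h

theorem coeffs_eq_zero_of_lt (h : TopAt φ g c p) (hg : φ g < φ g') : coeffs p g' = 0 := by
  by_contra h'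
  exact absurd (h.2 _ h') (not_le.2 hg)

theorem add (h : TopAt φ g c p) (h' : TopAt φ g c' p') : TopAt φ g (c + c') (p + p') := by
  refine ⟨by rw [map_add, Finsupp.add_apply, h.1, h'.1], fun k hk => ?_⟩
  by_contra hlt
  rw [map_add, Finsupp.add_apply, h.coeffs_eq_zero_of_lt (not_le.1 hlt),
    h'.coeffs_eq_zero_of_lt (not_le.1 hlt), add_zero] at hk
  exact hk rfl

theorem smul (h : TopAt φ g c p) (a : ℂ) : TopAt φ g (a * c) (a • p) := by
  refine ⟨by rw [map_smul, Finsupp.smul_apply, h.1, smul_eq_mul], fun k hk => h.2 k ?_⟩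
  rw [map_smul, Finsupp.smul_apply] at hk
  exact right_ne_zero_of_smul hk

theorem mul (hφ : Function.Injective φ) (h : TopAt φ g c p) (h' : TopAt φ g' c' p') :
    TopAt φ (g + g') (c * c' * (q : ℂ) ^ (g.2 * g'.1)) (p * p') := by
  constructor
  -- Only the pair of top exponents can sum to `g + g'`: neither summand can exceed its maximum
  -- under `φ`, so both attain it, and `φ` is injective.
  · have hz : ∀ k ∈ (coeffs p).support, ∀ k' ∈ (coeffs p').support, (k, k') ≠ (g, g') →
        k + k' ≠ g + g' := by
      intro k hk k' hk' hne heq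
      have h1 := h.2 k (Finsupp.mem_support_iff.1 hk)
      have h2 := h'.2 k' (Finsupp.mem_support_iff.1 hk')
      have h3 : φ k + φ k' = φ g + φ g' := by rw [← map_add, ← map_add, heq]
      exact hne (Prod.ext (hφ (by linarith)) (hφ (by linarith)))
    rw [coeffs_mul_apply, ← Finset.sum_product', Finset.sum_eq_single (g, g')]
    · rw [if_pos rfl, h.1, h'.1]
    · intro k hk hne
      rw [Finset.mem_product] at hk
      exact if_neg (hz _ hk.1 _ hk.2 hne)
    · intro hk
      rw [if_pos rfl]
      simp only [Finset.mem_product, Finsupp.mem_support_iff, not_and_or, not_not] at hk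
      rcases hk with hk | hk <;> rw [hk] <;> simp
  · intro k hk
    rw [coeffs_mul_apply] at hk
    obtain ⟨a, ha, hk⟩ := Finset.exists_ne_zero_of_sum_ne_zero hk
    obtain ⟨b, hb, hk⟩ := Finset.exists_ne_zero_of_sum_ne_zero hk
    have hab : a + b = k := by
      by_contra hab
      exact hk (if_neg hab)
    have h1 := h.2 a (Finsupp.mem_support_iff.1 ha)
    have h2 := h'.2 b (Finsupp.mem_support_iff.1 hb)
    rw [← hab, map_add, map_add]
    linarith

theorem zero (φ : ℤ × ℤ →+ ℝ) (g : ℤ × ℤ) : TopAt φ g 0 (0 : QPlane q) :=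
  ⟨by simp, fun h hh => by simp at hh⟩

theorem unique (hφ : Function.Injective φ) (h : TopAt φ g c p) (h' : TopAt φ g' c' p) (hc : c ≠ 0)
    (hc' : c' ≠ 0) : g = g' :=
  hφ (le_antisymm (h'.2 g (h.1.symm ▸ hc)) (h.2 g' (h'.1.symm ▸ hc')))

end TopAt

theorem topAt_monomial (φ : ℤ × ℤ →+ ℝ) (m n : ℕ) :
    TopAt φ ((m : ℤ), (n : ℤ)) 1 (x q ^ m * y q ^ n) := by
  refine ⟨by rw [coeffs_monomial, Finsupp.single_eq_same], fun h hh => ?_⟩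
  rw [coeffs_monomial, Finsupp.single_apply_ne_zero] at hh
  rw [hh.1]

theorem topAt_x (φ : ℤ × ℤ →+ ℝ) : TopAt φ (1, 0) 1 (x q) := by
  simpa using topAt_monomial (q := q) φ 1 0

theorem topAt_y (φ : ℤ × ℤ →+ ℝ) : TopAt φ (0, 1) 1 (y q) := by
  simpa using topAt_monomial (q := q) φ 0 1

theorem topAt_one (φ : ℤ × ℤ →+ ℝ) : TopAt φ (0, 0) 1 (1 : QPlane q) := by
  simpa using topAt_monomial (q := q) φ 0 0

theorem exists_topAt (φ : ℤ × ℤ →+ ℝ) {p : QPlane q} (hp : p ≠ 0) :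
    ∃ g c, c ≠ 0 ∧ TopAt φ g c p := by
  have hne : (coeffs p).support.Nonempty := by
    rw [Finsupp.support_nonempty_iff]
    exact (map_ne_zero_iff _ coeffs_injective).2 hp
  obtain ⟨g, hg, hmax⟩ := Finset.exists_max_image _ φ hne
  exact ⟨g, _, Finsupp.mem_support_iff.1 hg, rfl,
    fun h hh => hmax h (Finsupp.mem_support_iff.2 hh)⟩

/-- The leading term of the image of a polynomial under a linear map, for which the leading terms of
the images of the monomials are known. -/
theorem TopAt.map {φ φ' : ℤ × ℤ →+ ℝ} (hφ' : Function.Injective φ') {D : QPlane q →ₗ[ℂ] QPlane q}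
    {L : ℤ × ℤ → ℤ × ℤ} {κ : ℤ × ℤ → ℂ} (hL : ∀ h g, φ' h < φ' g → φ (L h) < φ (L g))
    (hD : ∀ m n : ℕ, TopAt φ (L (m, n)) (κ (m, n)) (D (x q ^ m * y q ^ n)))
    {g : ℤ × ℤ} {c : ℂ} {p : QPlane q} (hp : TopAt φ' g c p) :
    TopAt φ (L g) (c * κ g) (D p) := by
  have hD' : ∀ h, coeffs p h ≠ 0 → TopAt φ (L h) (κ h) (D (mono q h)) := by
    intro h hh
    obtain ⟨h1, h2⟩ := nonneg_of_coeffs_ne_zero hh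
    have := hD h.1.toNat h.2.toNat
    rwa [Int.toNat_of_nonneg h1, Int.toNat_of_nonneg h2] at this
  have hsum : ∀ k, coeffs (D p) k =
      ∑ h ∈ (coeffs p).support, coeffs p h * coeffs (D (mono q h)) k := by
    intro k
    conv_lhs => rw [← sum_coeffs p]
    simp [Finsupp.finsetSum_apply]
  have hlt : ∀ h, coeffs p h ≠ 0 → h ≠ g → φ (L h) < φ (L g) := fun h hh hne =>
    hL _ _ (lt_of_le_of_ne (hp.2 h hh) fun he => hne (hφ' he))
  constructor
  · rw [hsum, Finset.sum_eq_single g]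
    · rw [hp.1]
      by_cases hc : c = 0
      · rw [hc, zero_mul, zero_mul]
      · rw [(hD' g (hp.1.symm ▸ hc)).1]
    · intro h hh hne
      rw [Finsupp.mem_support_iff] at hh
      rw [(hD' h hh).coeffs_eq_zero_of_lt (hlt h hh hne), mul_zero]
    · intro hg
      rw [Finsupp.notMem_support_iff.1 hg, zero_mul]
  · intro k hk
    rw [hsum] at hk
    obtain ⟨h, hh, hk⟩ := Finset.exists_ne_zero_of_sum_ne_zero hk
    rw [Finsupp.mem_support_iff] at hh
    refine ((hD' h hh).2 k (right_ne_zero_of_mul hk)).trans ?_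
    by_cases hne : h = g
    · rw [hne]
    · exact (hlt h hh hne).le

end QPlane

/-! ### Automorphisms of the quantum plane. -/

namespace QPlane

variable {q : ℂˣ}

/-- An injective additive map from `ℤ × ℤ` to `ℝ`, which defines a linear order on exponents. -/
noncomputable def slope : ℤ × ℤ →+ ℝ where
  toFun g := g.1 + Real.sqrt 2 * g.2
  map_zero' := by simp
  map_add' g h := by simp; ring

theorem slope_apply (g : ℤ × ℤ) : slope g = g.1 + Real.sqrt 2 * g.2 := rfl

theorem slope_injective : Function.Injective slope := by
  rw [injective_iff_map_eq_zero]
  rintro ⟨m, n⟩ h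
  rw [slope_apply] at h
  have hn : n = 0 := by
    by_contra hn
    have hn' : (n : ℝ) ≠ 0 := Int.cast_ne_zero.2 hn
    refine irrational_sqrt_two ⟨-m / n, ?_⟩
    push_cast
    field_simp
    simp only at h
    linarith
  subst hn
  have hm : (m : ℝ) = 0 := by simpa using h
  rw [Int.cast_eq_zero] at hm
  rw [hm]
  rfl

/-- The opposite order, for which top terms are the lowest terms for `slope`. -/
theorem neg_slope_injective : Function.Injective (-slope) := fun g h hgh =>
  slope_injective (neg_injective (by simpa using hgh))

/-- The form in which the hypothesis on `q` is used: equalities between powers of `q` become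
equations between integer exponents. -/
theorem zpow_injective (hq : ∀ n : ℤ, n ≠ 0 → q ^ n ≠ 1) {m n : ℤ}
    (h : (q : ℂ) ^ m = (q : ℂ) ^ n) : m = n := by
  by_contra hne
  refine hq (m - n) (sub_ne_zero.2 hne) (Units.ext ?_)
  push_cast
  rw [zpow_sub₀ q.ne_zero, h, div_self (zpow_ne_zero _ q.ne_zero)]

theorem x_ne_zero : x q ≠ 0 := by
  intro h
  have := coeffs_x (q := q)
  rw [h, map_zero] at this
  simpa using DFunLike.congr_fun this (1, 0)

theorem y_ne_zero : y q ≠ 0 := by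
  intro h
  have := coeffs_y (q := q)
  rw [h, map_zero] at this
  simpa using DFunLike.congr_fun this (0, 1)

theorem TopAt.pow {φ : ℤ × ℤ →+ ℝ} (hφ : Function.Injective φ) {g : ℤ × ℤ} {c : ℂ}
    {p : QPlane q} (hc : c ≠ 0) (h : TopAt φ g c p) (n : ℕ) :
    ∃ c', c' ≠ 0 ∧ TopAt φ (n * g.1, n * g.2) c' (p ^ n) := by
  induction n with
  | zero => exact ⟨1, one_ne_zero, by simpa using topAt_one φ⟩
  | succ n ih =>
    obtain ⟨c', hc', ih⟩ := ih
    rw [pow_succ]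
    refine ⟨_, mul_ne_zero (mul_ne_zero hc' hc) (zpow_ne_zero _ q.ne_zero),
      (ih.mul hφ h).of_eq ?_ rfl⟩
    ext <;> push_cast <;> simp <;> ring

/-- For every order, an automorphism maps `x` and `y` to polynomials with leading exponents
`(1, 0)` and `(0, 1)`. -/
theorem exists_topAt_algEquiv (hq : ∀ n : ℤ, n ≠ 0 → q ^ n ≠ 1) (Ψ : QPlane q ≃ₐ[ℂ] QPlane q)
    {φ : ℤ × ℤ →+ ℝ} (hφ : Function.Injective φ) :
    (∃ c, TopAt φ (1, 0) c (Ψ (x q))) ∧ ∃ c, TopAt φ (0, 1) c (Ψ (y q)) := by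
  obtain ⟨u, c, hc, hu⟩ := exists_topAt φ (p := Ψ (x q)) (by simpa using x_ne_zero)
  obtain ⟨v, d, hd, hv⟩ := exists_topAt φ (p := Ψ (y q)) (by simpa using y_ne_zero)
  -- The leading coefficients in `Ψ(y)Ψ(x) = qΨ(x)Ψ(y)` differ only by powers of `q`, so the leading
  -- exponents of `Ψ(x)` and `Ψ(y)` form a matrix of determinant 1.
  have hdet : v.2 * u.1 = 1 + u.2 * v.1 := by
    have h1 := hv.mul hφ hu
    rw [← map_mul, y_mul_x, map_smul, map_mul, add_comm] at h1
    have h2 := h1.1.symm.trans ((hu.mul hφ hv).smul (q : ℂ)).1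
    refine zpow_injective hq (mul_left_cancel₀ (mul_ne_zero hd hc) ?_)
    rw [h2, zpow_add₀ q.ne_zero, zpow_one]
    ring
  have hu0 := nonneg_of_coeffs_ne_zero (hu.1.symm ▸ hc)
  have hv0 := nonneg_of_coeffs_ne_zero (hv.1.symm ▸ hd)
  -- `L` sends an exponent to the leading exponent of the image of its monomial, and it is injective
  -- by `hdet`. With sources ordered by the pullback `φ'`, `L` is strictly monotone by definition,
  -- so leading terms are carried to leading terms.
  let L : ℤ × ℤ → ℤ × ℤ := fun g => (g.1 * u.1 + g.2 * v.1, g.1 * u.2 + g.2 * v.2)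
  let φ' : ℤ × ℤ →+ ℝ := φ.comp
    { toFun := L
      map_zero' := by simp [L]
      map_add' := fun g h => by ext <;> simp [L] <;> ring }
  have hφ' : Function.Injective φ' := by
    refine hφ.comp fun g h hgh => ?_
    obtain ⟨h1, h2⟩ := Prod.ext_iff.1 hgh
    simp only [AddMonoidHom.coe_mk, ZeroHom.coe_mk, L] at h1 h2
    ext
    · linear_combination v.2 * h1 - v.1 * h2 + (h.1 - g.1) * hdet
    · linear_combination u.1 * h2 - u.2 * h1 + (h.2 - g.2) * hdet
  have hmon : ∀ m n : ℕ, ∃ κ, κ ≠ 0 ∧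
      TopAt φ (L (m, n)) κ (Ψ.toLinearMap (x q ^ m * y q ^ n)) := by
    intro m n
    obtain ⟨c', hc', h1⟩ := hu.pow hφ hc m
    obtain ⟨d', hd', h2⟩ := hv.pow hφ hd n
    have h3 := h1.mul hφ h2
    rw [AlgEquiv.toLinearMap_apply, map_mul, map_pow, map_pow]
    exact ⟨_, mul_ne_zero (mul_ne_zero hc' hd') (zpow_ne_zero _ q.ne_zero), h3⟩
  choose κ hκ hmon using hmon
  -- Surjectivity of `Ψ`: a leading exponent of any element is `L` of the leading exponent of its
  -- preimage, hence a combination of `u` and `v` with nonnegative coefficients.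
  have key : ∀ {p : QPlane q} {g : ℤ × ℤ}, TopAt φ g 1 p →
      ∃ h : ℤ × ℤ, 0 ≤ h.1 ∧ 0 ≤ h.2 ∧ L h = g := by
    intro p g hp
    have hne : Ψ.symm p ≠ 0 := by
      intro h0
      rw [map_eq_zero_iff _ Ψ.symm.injective] at h0
      subst h0
      simpa using hp.1
    obtain ⟨h, b, hb, htop⟩ := exists_topAt φ' hne
    have h0 := nonneg_of_coeffs_ne_zero (htop.1.symm ▸ hb)
    have := TopAt.map (D := Ψ.toLinearMap) (L := L) (κ := fun g => κ g.1.toNat g.2.toNat) hφ' (φ := φ)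
      (fun _ _ h => h) (fun m n => by simpa using hmon m n) htop
    rw [AlgEquiv.toLinearMap_apply, AlgEquiv.apply_symm_apply] at this
    exact ⟨h, h0.1, h0.2, this.unique hφ hp (mul_ne_zero hb (hκ _ _)) one_ne_zero⟩
  obtain ⟨⟨i, j⟩, hi, hj, h1⟩ := key (topAt_x φ)
  obtain ⟨⟨i', j'⟩, hi', hj', h2⟩ := key (topAt_y φ)
  obtain ⟨u1, u2⟩ := u
  obtain ⟨v1, v2⟩ := v
  simp only [L, Prod.mk.injEq] at h1 h2 hi hj hi' hj' hu0 hv0 hdet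
  obtain ⟨a1, a2⟩ := h1
  obtain ⟨a3, a4⟩ := h2
  -- The matrix of `u` and `v` has nonnegative integer entries and a nonnegative integer inverse.
  -- Determinant 1 makes its diagonal positive, which rules out the swap and leaves the identity.
  have hv2 : 0 < v2 := by
    refine lt_of_le_of_ne hv0.2 fun h => ?_
    nlinarith [mul_nonneg hu0.2 hv0.1]
  have hu1 : 0 < u1 := by
    refine lt_of_le_of_ne hu0.1 fun h => ?_
    nlinarith [mul_nonneg hu0.2 hv0.1]
  have hj0 : j = 0 := by nlinarith [mul_nonneg hi hu0.2, mul_nonneg hj hv0.2]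
  have hi0 : i' = 0 := by nlinarith [mul_nonneg hi' hu0.1, mul_nonneg hj' hv0.1]
  subst hj0 hi0
  simp only [zero_mul, add_zero, zero_add] at a1 a2 a3 a4
  obtain ⟨rfl, rfl⟩ : i = 1 ∧ u1 = 1 := by
    rcases Int.mul_eq_one_iff_eq_one_or_neg_one.1 a1 with h | h <;> omega
  obtain ⟨rfl, rfl⟩ : j' = 1 ∧ v2 = 1 := by
    rcases Int.mul_eq_one_iff_eq_one_or_neg_one.1 a4 with h | h <;> omega
  rw [one_mul] at a2 a3
  subst a2 a3
  exact ⟨⟨c, hu⟩, ⟨d, hv⟩⟩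

/-- Every automorphism of the quantum plane rescales the generators. -/
theorem algEquiv_x_y (hq : ∀ n : ℤ, n ≠ 0 → q ^ n ≠ 1) (Ψ : QPlane q ≃ₐ[ℂ] QPlane q) :
    ∃ α β : ℂˣ, Ψ (x q) = (α : ℂ) • x q ∧ Ψ (y q) = (β : ℂ) • y q := by
  -- If the largest and the smallest exponent for `slope` coincide, there is at most one monomial.
  have key : ∀ {p : QPlane q} {g : ℤ × ℤ}, (∃ c, TopAt slope g c p) → (∃ c, TopAt (-slope) g c p) →
      ∀ h, coeffs p h ≠ 0 → h = g := by
    rintro p g ⟨c, h1⟩ ⟨c', h2⟩ h hh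
    have h3 := h2.2 h hh
    simp only [AddMonoidHom.neg_apply, neg_le_neg_iff] at h3
    exact slope_injective (le_antisymm (h1.2 h hh) h3)
  obtain ⟨hx, hy⟩ := exists_topAt_algEquiv hq Ψ slope_injective
  obtain ⟨hx', hy'⟩ := exists_topAt_algEquiv hq Ψ neg_slope_injective
  have hX : Ψ (x q) = coeffs (Ψ (x q)) (1, 0) • x q := by
    refine coeffs_injective (Finsupp.ext fun g => ?_)
    by_cases hg : g = (1, 0)
    · simp [hg, coeffs_x]
    · rw [map_smul, coeffs_x, Finsupp.smul_apply, Finsupp.single_eq_of_ne hg, smul_zero]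
      by_contra h
      exact hg (key hx hx' g h)
  have hY : Ψ (y q) = coeffs (Ψ (y q)) (0, 1) • y q := by
    refine coeffs_injective (Finsupp.ext fun g => ?_)
    by_cases hg : g = (0, 1)
    · simp [hg, coeffs_y]
    · rw [map_smul, coeffs_y, Finsupp.smul_apply, Finsupp.single_eq_of_ne hg, smul_zero]
      by_contra h
      exact hg (key hy hy' g h)
  refine ⟨Units.mk0 _ ?_, Units.mk0 _ ?_, hX, hY⟩
  · intro h
    rw [h, zero_smul, map_eq_zero_iff _ Ψ.injective] at hX
    exact x_ne_zero hX
  · intro h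
    rw [h, zero_smul, map_eq_zero_iff _ Ψ.injective] at hY
    exact y_ne_zero hY

end QPlane

/-! ### Diagonal automorphisms, skew derivations and the swap. -/

namespace QPlane

variable {q : ℂˣ}

theorem induction {P : QPlane q → Prop} (hs : ∀ c : ℂ, P (algebraMap ℂ (QPlane q) c))
    (hx : P (x q)) (hy : P (y q)) (hmul : ∀ a b, P a → P b → P (a * b))
    (hadd : ∀ a b, P a → P b → P (a + b)) (p : QPlane q) : P p := by
  obtain ⟨w, rfl⟩ := RingQuot.mkAlgHom_surjective ℂ (QPlaneRel q) p
  induction w using FreeAlgebra.induction with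
  | grade0 c => rw [AlgHom.commutes]; exact hs c
  | grade1 g => cases g; exacts [hx, hy]
  | mul a b ha hb => rw [map_mul]; exact hmul _ _ ha hb
  | add a b ha hb => rw [map_add]; exact hadd _ _ ha hb

theorem algHom_ext {B : Type*} [Ring B] [Algebra ℂ B] {φ ψ : QPlane q →ₐ[ℂ] B}
    (hx : φ (x q) = ψ (x q)) (hy : φ (y q) = ψ (y q)) : φ = ψ := by
  refine AlgHom.ext fun p => ?_
  induction p using induction with
  | hs c => rw [AlgHom.commutes, AlgHom.commutes]
  | hx => exact hx
  | hy => exact hy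
  | hmul a b ha hb => rw [map_mul, map_mul, ha, hb]
  | hadd a b ha hb => rw [map_add, map_add, ha, hb]

/-- The endomorphism `x ↦ α x`, `y ↦ β y`. -/
noncomputable def diag (α β : ℂˣ) : QPlane q →ₐ[ℂ] QPlane q :=
  lift ((α : ℂ) • x q) ((β : ℂ) • y q) (by
    rw [smul_mul_smul_comm, y_mul_x, smul_mul_smul_comm, smul_smul, smul_smul]
    congr 1
    ring)

@[simp]
theorem diag_x (α β : ℂˣ) : diag α β (x q) = (α : ℂ) • x q := lift_x _ _ _

@[simp]
theorem diag_y (α β : ℂˣ) : diag α β (y q) = (β : ℂ) • y q := lift_y _ _ _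

theorem diag_diag (α β α' β' : ℂˣ) (p : QPlane q) :
    diag α β (diag α' β' p) = diag (α * α') (β * β') p := by
  have : (diag α β).comp (diag α' β') = diag (q := q) (α * α') (β * β') :=
    algHom_ext (by simp [smul_smul, mul_comm]) (by simp [smul_smul, mul_comm])
  exact AlgHom.congr_fun this p

theorem diag_one_one (p : QPlane q) : diag 1 1 p = p := by
  have : diag 1 1 = AlgHom.id ℂ (QPlane q) := algHom_ext (by simp) (by simp)
  exact AlgHom.congr_fun this p

@[simp]
theorem diag_inv_diag (α β : ℂˣ) (p : QPlane q) : diag α⁻¹ β⁻¹ (diag α β p) = p := by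
  rw [diag_diag, inv_mul_cancel, inv_mul_cancel, diag_one_one]

@[simp]
theorem diag_diag_inv (α β : ℂˣ) (p : QPlane q) : diag α β (diag α⁻¹ β⁻¹ p) = p := by
  rw [diag_diag, mul_inv_cancel, mul_inv_cancel, diag_one_one]

theorem diag_monomial (α β : ℂˣ) (m n : ℕ) : diag α β (x q ^ m * y q ^ n) =
    ((α : ℂ) ^ m * (β : ℂ) ^ n) • (x q ^ m * y q ^ n) := by
  simp only [map_mul, map_pow, diag_x, diag_y, smul_pow, smul_mul_smul_comm]

theorem coeffs_diag (α β : ℂˣ) (p : QPlane q) (i j : ℤ) :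
    coeffs (diag α β p) (i, j) = (α : ℂ) ^ i * (β : ℂ) ^ j * coeffs p (i, j) := by
  have : Finsupp.lapply (R := ℂ) (i, j) ∘ₗ coeffs ∘ₗ (diag α β).toLinearMap =
      ((α : ℂ) ^ i * (β : ℂ) ^ j) • Finsupp.lapply (R := ℂ) (i, j) ∘ₗ coeffs (q := q) :=
    linear_ext fun m n => by
      simp only [LinearMap.comp_apply, AlgHom.toLinearMap_apply, diag_monomial, map_smul,
        LinearMap.smul_apply, Finsupp.lapply_apply, coeffs_monomial, smul_eq_mul,
        Finsupp.single_apply, Prod.mk.injEq]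
      by_cases h : (m : ℤ) = i ∧ (n : ℤ) = j
      · obtain ⟨rfl, rfl⟩ := h
        simp
      · rw [if_neg h, mul_zero, mul_zero]
  exact LinearMap.congr_fun this p

/-- A `(σ, τ)`-skew derivation. -/
def IsSkewDer (σ τ : QPlane q →ₐ[ℂ] QPlane q) (D : QPlane q →ₗ[ℂ] QPlane q) : Prop :=
  ∀ a b, D (a * b) = σ a * D b + D a * τ b

theorem IsSkewDer.map_one {σ τ : QPlane q →ₐ[ℂ] QPlane q} {D : QPlane q →ₗ[ℂ] QPlane q}
    (hD : IsSkewDer σ τ D) : D 1 = 0 := by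
  have := hD 1 1
  simpa using this

/-- The skew Leibniz rule propagates agreement to products. Identities between operators are
therefore checked on `x` and `y` once both sides are skew for the same pair. -/
theorem IsSkewDer.ext {σ τ : QPlane q →ₐ[ℂ] QPlane q} {D D' : QPlane q →ₗ[ℂ] QPlane q}
    (hD : IsSkewDer σ τ D) (hD' : IsSkewDer σ τ D') (hx : D (x q) = D' (x q))
    (hy : D (y q) = D' (y q)) : D = D' := by
  refine LinearMap.ext fun p => ?_
  induction p using induction with
  | hs c => rw [Algebra.algebraMap_eq_smul_one, map_smul, map_smul, hD.map_one, hD'.map_one]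
  | hx => exact hx
  | hy => exact hy
  | hmul a b ha hb => rw [hD, hD', ha, hb]
  | hadd a b ha hb => rw [map_add, map_add, ha, hb]

theorem isSkewDer_zero (σ τ : QPlane q →ₐ[ℂ] QPlane q) : IsSkewDer σ τ 0 := fun a b => by simp

/-- Skew derivations are determined by arbitrary values on the generators that are compatible with
the defining relation. -/
theorem exists_isSkewDer (σ τ : QPlane q →ₐ[ℂ] QPlane q) (a b : QPlane q)
    (h : σ (y q) * a + b * τ (x q) = (q : ℂ) • (σ (x q) * b + a * τ (y q))) :
    ∃ D, IsSkewDer σ τ D ∧ D (x q) = a ∧ D (y q) = b := by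
  -- `D` is a `(σ, τ)`-skew derivation exactly when `p ↦ !![σ p, D p; 0, τ p]` is multiplicative.
  -- The universal property produces this homomorphism, and `h` is the upper right entry of the
  -- defining relation.
  let Θ : QPlane q →ₐ[ℂ] Matrix (Fin 2) (Fin 2) (QPlane q) :=
    lift !![σ (x q), a; 0, τ (x q)] !![σ (y q), b; 0, τ (y q)] (by
      ext i j
      fin_cases i <;> fin_cases j <;>
        simp [Matrix.mul_apply, Fin.sum_univ_two, ← map_mul, y_mul_x, h])
  have key : ∀ p, Θ p 0 0 = σ p ∧ Θ p 1 0 = 0 ∧ Θ p 1 1 = τ p := by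
    intro p
    induction p using induction with
    | hs c =>
      rw [AlgHom.commutes, AlgHom.commutes, AlgHom.commutes]
      simp [Matrix.algebraMap_matrix_apply]
    | hx => simp [Θ]
    | hy => simp [Θ]
    | hmul a b ha hb => simp [Matrix.mul_apply, Fin.sum_univ_two, ha, hb]
    | hadd a b ha hb => simp [ha, hb]
  refine ⟨Matrix.entryLinearMap ℂ (QPlane q) 0 1 ∘ₗ Θ.toLinearMap, fun u v => ?_, ?_, ?_⟩
  · simp [Matrix.mul_apply, Fin.sum_univ_two, key]
  · simp [Θ]
  · simp [Θ]

/-- The anti-automorphism that swaps `x` and `y`, as a homomorphism to the opposite algebra. -/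
noncomputable def swapHom (q : ℂˣ) : QPlane q →ₐ[ℂ] (QPlane q)ᵐᵒᵖ :=
  lift (.op (y q)) (.op (x q)) (by
    rw [← MulOpposite.op_mul, ← MulOpposite.op_mul, y_mul_x, MulOpposite.op_smul])

/-- The anti-automorphism that swaps `x` and `y`. -/
noncomputable def swap : QPlane q →ₗ[ℂ] QPlane q :=
  (MulOpposite.opLinearEquiv ℂ).symm.toLinearMap ∘ₗ (swapHom q).toLinearMap

theorem swap_mul (a b : QPlane q) : swap (a * b) = swap b * swap a := by simp [swap]

@[simp]
theorem swap_one : swap (1 : QPlane q) = 1 := by simp [swap]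

@[simp]
theorem swap_x : swap (x q) = y q := by simp [swap, swapHom]

@[simp]
theorem swap_y : swap (y q) = x q := by simp [swap, swapHom]

theorem swap_algebraMap (c : ℂ) : swap (algebraMap ℂ (QPlane q) c) = algebraMap ℂ _ c := by
  rw [Algebra.algebraMap_eq_smul_one, map_smul, swap_one]

theorem swap_pow (a : QPlane q) (n : ℕ) : swap (a ^ n) = swap a ^ n := by
  induction n with
  | zero => simp
  | succ n ih => rw [pow_succ, swap_mul, ih, pow_succ']

@[simp]
theorem swap_swap (p : QPlane q) : swap (swap p) = p := by
  induction p using induction with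
  | hs c => rw [swap_algebraMap, swap_algebraMap]
  | hx => simp
  | hy => simp
  | hmul a b ha hb => rw [swap_mul, swap_mul, ha, hb]
  | hadd a b ha hb => rw [map_add, map_add, ha, hb]

theorem swap_diag (α β : ℂˣ) (p : QPlane q) : swap (diag α β p) = diag β α (swap p) := by
  induction p using induction with
  | hs c => simp only [AlgHom.commutes, swap_algebraMap]
  | hx => simp
  | hy => simp
  | hmul a b ha hb => rw [map_mul, swap_mul, swap_mul, ha, hb, map_mul]
  | hadd a b ha hb => rw [map_add, map_add, ha, hb, map_add, map_add]

end QPlane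

/-! ### Module algebra structures as weights with two skew derivations. -/

open QPlane in
/-- Weight constants of `k` and skew derivations `E`, `F` of the quantum plane that satisfy the
relations of `U_q(sl_2)`. -/
structure SkewTriple (q : ℂˣ) where
  (α β : ℂˣ)
  (E F : QPlane q →ₗ[ℂ] QPlane q)
  E_mul : IsSkewDer (AlgHom.id ℂ _) (diag α β) E
  F_mul : IsSkewDer (diag α⁻¹ β⁻¹) (AlgHom.id ℂ _) F
  K_E : ∀ a, diag α β (E a) = ((q : ℂ) ^ 2) • E (diag α β a)
  K_F : ∀ a, diag α β (F a) = ((q : ℂ) ^ (-2 : ℤ)) • F (diag α β a)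
  E_F : ∀ a, E (F a) - F (E a) =
    ((q : ℂ) - (q : ℂ)⁻¹)⁻¹ • (diag α β a - diag α⁻¹ β⁻¹ a)

namespace SkewTriple

open QPlane

variable {q : ℂˣ}

/-- The full action matrix of a triple. -/
noncomputable def matrix (T : SkewTriple q) : Matrix (Fin 3) (Fin 2) (QPlane q) :=
  !![(T.α : ℂ) • x q, (T.β : ℂ) • y q; T.E (x q), T.E (y q); T.F (x q), T.F (y q)]

theorem Kinv_E (T : SkewTriple q) (a : QPlane q) :
    diag T.α⁻¹ T.β⁻¹ (T.E a) = ((q : ℂ) ^ (-2 : ℤ)) • T.E (diag T.α⁻¹ T.β⁻¹ a) := by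
  have h := congrArg (diag T.α⁻¹ T.β⁻¹) (T.K_E (diag T.α⁻¹ T.β⁻¹ a))
  rw [map_smul, diag_inv_diag, diag_diag_inv] at h
  rw [h, smul_smul, zpow_neg, zpow_ofNat, inv_mul_cancel₀ (pow_ne_zero _ q.ne_zero), one_smul]

theorem Kinv_F (T : SkewTriple q) (a : QPlane q) :
    diag T.α⁻¹ T.β⁻¹ (T.F a) = ((q : ℂ) ^ 2) • T.F (diag T.α⁻¹ T.β⁻¹ a) := by
  have h := congrArg (diag T.α⁻¹ T.β⁻¹) (T.K_F (diag T.α⁻¹ T.β⁻¹ a))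
  rw [map_smul, diag_inv_diag, diag_diag_inv] at h
  rw [h, smul_smul, zpow_neg, zpow_ofNat, mul_inv_cancel₀ (pow_ne_zero _ q.ne_zero), one_smul]

/-- The symmetry that swaps `x` with `y` and `e` with `f`. -/
noncomputable def flip (T : SkewTriple q) : SkewTriple q where
  -- Reversing products moves the twist `k⁻¹` of `F` from the left factor to the right, where the
  -- new `E` has its twist `k`. Hence the weights are inverted as well as exchanged.
  α := T.β⁻¹
  β := T.α⁻¹
  E := swap ∘ₗ T.F ∘ₗ swap
  F := swap ∘ₗ T.E ∘ₗ swap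
  E_mul a b := by
    simp only [LinearMap.comp_apply, swap_mul, T.F_mul _ _, AlgHom.id_apply, map_add, swap_swap,
      swap_diag]
    exact add_comm _ _
  F_mul a b := by
    simp only [LinearMap.comp_apply, swap_mul, T.E_mul _ _, AlgHom.id_apply, map_add, swap_swap,
      swap_diag, inv_inv]
    exact add_comm _ _
  K_E a := by
    simp only [LinearMap.comp_apply, ← swap_diag, Kinv_F, map_smul]
  K_F a := by
    simp only [LinearMap.comp_apply, ← swap_diag, Kinv_E, map_smul]
  E_F a := by
    have h := congrArg swap (T.E_F (swap a))
    simp only [map_sub, map_smul, swap_diag, swap_swap] at h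
    simp only [LinearMap.comp_apply, swap_swap, inv_inv]
    rw [← neg_sub, h, ← smul_neg, neg_sub]

/-- A triple is determined by compatible values on the generators. -/
theorem exists_of_generators (α β : ℂˣ) (ex ey fx fy : QPlane q)
    (hE : y q * ex + (α : ℂ) • (ey * x q) = (q : ℂ) • (x q * ey + (β : ℂ) • (ex * y q)))
    (hF : fy * x q + (β : ℂ)⁻¹ • (y q * fx) = (q : ℂ) • (fx * y q + (α : ℂ)⁻¹ • (x q * fy)))
    (hex : diag α β ex = ((q : ℂ) ^ 2 * α) • ex) (hey : diag α β ey = ((q : ℂ) ^ 2 * β) • ey)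
    (hfx : diag α β fx = ((q : ℂ) ^ (-2 : ℤ) * α) • fx)
    (hfy : diag α β fy = ((q : ℂ) ^ (-2 : ℤ) * β) • fy)
    (hEF : ∀ E F, IsSkewDer (AlgHom.id ℂ _) (diag α β) E →
      IsSkewDer (diag α⁻¹ β⁻¹) (AlgHom.id ℂ _) F →
      E (x q) = ex → E (y q) = ey → F (x q) = fx → F (y q) = fy →
      E fx - F ex = (((q : ℂ) - (q : ℂ)⁻¹)⁻¹ * (α - (α : ℂ)⁻¹)) • x q ∧
      E fy - F ey = (((q : ℂ) - (q : ℂ)⁻¹)⁻¹ * (β - (β : ℂ)⁻¹)) • y q) :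
    ∃ T : SkewTriple q,
      T.matrix = !![(α : ℂ) • x q, (β : ℂ) • y q; ex, ey; fx, fy] := by
  obtain ⟨E, E_mul, E_x, E_y⟩ := exists_isSkewDer (AlgHom.id ℂ _) (diag α β) ex ey
    (by simpa using hE)
  obtain ⟨F, F_mul, F_x, F_y⟩ := exists_isSkewDer (diag α⁻¹ β⁻¹) (AlgHom.id ℂ _) fx fy
    (by simpa [add_comm] using hF)
  obtain ⟨hx, hy⟩ := hEF E F E_mul F_mul E_x E_y F_x F_y
  -- Both sides are skew derivations for `(k, k²)`, so the hypotheses on `ex` and `ey` suffice. The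
  -- next relation is similar, with the pair `(1, k)`.
  have K_E : ∀ a, diag α β (E a) = ((q : ℂ) ^ 2) • E (diag α β a) := by
    have : (diag α β).toLinearMap ∘ₗ E = ((q : ℂ) ^ 2) • (E ∘ₗ (diag α β).toLinearMap) := by
      refine IsSkewDer.ext (σ := diag α β) (τ := diag (α * α) (β * β)) (fun a b => ?_)
        (fun a b => ?_) ?_ ?_
      · simp [E_mul _ _, diag_diag]
      · simp [E_mul _ _, diag_diag]
      · simp [E_x, hex, smul_smul]
      · simp [E_y, hey, smul_smul]
    exact LinearMap.congr_fun this
  have K_F : ∀ a, diag α β (F a) = ((q : ℂ) ^ (-2 : ℤ)) • F (diag α β a) := by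
    have : (diag α β).toLinearMap ∘ₗ F =
        ((q : ℂ) ^ (-2 : ℤ)) • (F ∘ₗ (diag α β).toLinearMap) := by
      refine IsSkewDer.ext (σ := AlgHom.id ℂ _) (τ := diag α β) (fun a b => ?_)
        (fun a b => ?_) ?_ ?_
      · simp [F_mul _ _]
      · simp [F_mul _ _]
      · simp [F_x, hfx, smul_smul]
      · simp [F_y, hfy, smul_smul]
    exact LinearMap.congr_fun this
  have Kinv_E : ∀ a, diag α⁻¹ β⁻¹ (E a) = ((q : ℂ) ^ (-2 : ℤ)) • E (diag α⁻¹ β⁻¹ a) := by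
    intro a
    have h := congrArg (diag α⁻¹ β⁻¹) (K_E (diag α⁻¹ β⁻¹ a))
    rw [map_smul, diag_inv_diag, diag_diag_inv] at h
    rw [h, smul_smul, zpow_neg, zpow_ofNat, inv_mul_cancel₀ (pow_ne_zero _ q.ne_zero), one_smul]
  refine ⟨⟨α, β, E, F, E_mul, F_mul, K_E, K_F, fun a => ?_⟩, by
    simp only [matrix, E_x, E_y, F_x, F_y]⟩
  -- Both sides are `(k⁻¹, k)`-skew derivations. On the left the mixed terms `E k⁻¹ a · k F b` and
  -- `k⁻¹ E a · F k b` cancel, because `E` and `F` have inverse weights.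
  have : E ∘ₗ F - F ∘ₗ E = ((q : ℂ) - (q : ℂ)⁻¹)⁻¹ •
      ((diag α β).toLinearMap - (diag α⁻¹ β⁻¹).toLinearMap) := by
    refine IsSkewDer.ext (σ := diag α⁻¹ β⁻¹) (τ := diag α β) (fun a b => ?_)
        (fun a b => ?_) ?_ ?_
    · simp only [LinearMap.sub_apply, LinearMap.comp_apply, E_mul _ _, F_mul _ _, map_add,
        AlgHom.id_apply, K_F, Kinv_E, mul_sub, sub_mul, smul_mul_assoc, mul_smul_comm]
      rw [zpow_neg, zpow_ofNat]
      abel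
    · simp only [LinearMap.smul_apply, LinearMap.sub_apply, AlgHom.toLinearMap_apply, map_mul,
        smul_mul_assoc, mul_smul_comm, mul_sub, sub_mul, ← smul_add]
      congr 1
      abel
    · simp [E_x, F_x, hx, smul_smul, ← sub_smul]
    · simp [E_y, F_y, hy, smul_smul, ← sub_smul]
  exact LinearMap.congr_fun this a

end SkewTriple

/-! ### Correspondence between structures and triples. -/

namespace QPlaneAction

open QPlane

variable {q : ℂˣ}

theorem gen_mul (π : QPlaneAction q) (g : UqGen) (a b : QPlane q) :
    π.toHom (Uq.gen q g) (a * b) =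
      match g with
      | .k => π.toHom (Uq.gen q .k) a * π.toHom (Uq.gen q .k) b
      | .kinv => π.toHom (Uq.gen q .kinv) a * π.toHom (Uq.gen q .kinv) b
      | .e => a * π.toHom (Uq.gen q .e) b + π.toHom (Uq.gen q .e) a * π.toHom (Uq.gen q .k) b
      | .f => π.toHom (Uq.gen q .f) a * b +
          π.toHom (Uq.gen q .kinv) a * π.toHom (Uq.gen q .f) b := by
  rw [π.map_mul', Uq.comul_gen]
  cases g <;> simp [Uq.comulGen]

theorem gen_one (π : QPlaneAction q) (g : UqGen) :
    π.toHom (Uq.gen q g) 1 = Uq.counitGen g • (1 : QPlane q) := by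
  rw [π.map_one', Uq.counit_gen]

theorem kinv_k (π : QPlaneAction q) (a : QPlane q) :
    π.toHom (Uq.gen q .kinv) (π.toHom (Uq.gen q .k) a) = a := by
  rw [← Module.End.mul_apply, ← map_mul, Uq.kinv_mul_k, map_one, Module.End.one_apply]

theorem k_kinv (π : QPlaneAction q) (a : QPlane q) :
    π.toHom (Uq.gen q .k) (π.toHom (Uq.gen q .kinv) a) = a := by
  rw [← Module.End.mul_apply, ← map_mul, Uq.k_mul_kinv, map_one, Module.End.one_apply]

/-- The automorphism by which `k` acts. -/
noncomputable def kEquiv (π : QPlaneAction q) : QPlane q ≃ₐ[ℂ] QPlane q :=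
  AlgEquiv.ofAlgHom
    (AlgHom.ofLinearMap (π.toHom (Uq.gen q .k)) (by simp [gen_one, Uq.counitGen]) (π.gen_mul .k))
    (AlgHom.ofLinearMap (π.toHom (Uq.gen q .kinv)) (by simp [gen_one, Uq.counitGen])
      (π.gen_mul .kinv))
    (AlgHom.ext π.k_kinv) (AlgHom.ext π.kinv_k)

/-- The triple that describes a module algebra structure. -/
theorem exists_skewTriple (hq : ∀ n : ℤ, n ≠ 0 → q ^ n ≠ 1) (π : QPlaneAction q) :
    ∃ T : SkewTriple q, T.matrix = π.fullMatrix := by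
  obtain ⟨α, β, hα, hβ⟩ := algEquiv_x_y hq π.kEquiv
  have hk : ∀ a, π.toHom (Uq.gen q .k) a = diag α β a := by
    have : π.kEquiv.toAlgHom = diag α β := algHom_ext (by simpa using hα) (by simpa using hβ)
    exact AlgHom.congr_fun this
  have hkinv : ∀ a, π.toHom (Uq.gen q .kinv) a = diag α⁻¹ β⁻¹ a := by
    intro a
    conv_lhs => rw [← diag_diag_inv α β a, ← hk, kinv_k]
  refine ⟨⟨α, β, π.toHom (Uq.gen q .e), π.toHom (Uq.gen q .f), fun a b => ?_, fun a b => ?_,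
    fun a => ?_, fun a => ?_, fun a => ?_⟩, ?_⟩
  · rw [π.gen_mul]
    simp only [hk, AlgHom.id_apply]
  · rw [π.gen_mul]
    simp only [hkinv, AlgHom.id_apply]
    exact add_comm _ _
  · have h := LinearMap.congr_fun (congrArg π.toHom (Uq.k_mul_e (q := q))) a
    simpa only [map_mul, map_smul, Module.End.mul_apply, LinearMap.smul_apply, hk] using h
  · have h := LinearMap.congr_fun (congrArg π.toHom (Uq.k_mul_f (q := q))) a
    simpa only [map_mul, map_smul, Module.End.mul_apply, LinearMap.smul_apply, hk] using h
  · have h := LinearMap.congr_fun (congrArg π.toHom (Uq.e_mul_f_sub (q := q))) a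
    simpa only [map_sub, map_mul, map_smul, Module.End.mul_apply, LinearMap.smul_apply,
      LinearMap.sub_apply, hk, hkinv] using h
  · simp only [SkewTriple.matrix, fullMatrix, hk, diag_x, diag_y]

/-- The module algebra structure that is described by a triple. -/
theorem exists_of_skewTriple (T : SkewTriple q) :
    ∃ π : QPlaneAction q, π.fullMatrix = T.matrix := by
  let φ : UqGen → Module.End ℂ (QPlane q)
    | .k => (diag T.α T.β).toLinearMap
    | .kinv => (diag T.α⁻¹ T.β⁻¹).toLinearMap
    | .e => T.E
    | .f => T.F
  let ρ : Uq q →ₐ[ℂ] Module.End ℂ (QPlane q) := Uq.lift φ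
    (LinearMap.ext fun a => by simp [φ]) (LinearMap.ext fun a => by simp [φ])
    (LinearMap.ext fun a => by simp [φ, T.K_E]) (LinearMap.ext fun a => by simp [φ, T.K_F])
    (LinearMap.ext fun a => by simp [φ, T.E_F])
  have hρ : ∀ g, ρ (Uq.gen q g) = φ g := fun g => Uq.lift_gen _ _ _ _ _ _ g
  -- `R` is the componentwise action of `U ⊗ U` on `A ⊗ A`.
  let R : Uq q ⊗[ℂ] Uq q →ₐ[ℂ] Module.End ℂ (QPlane q ⊗[ℂ] QPlane q) :=
    Module.endTensorEndAlgHom.comp (Algebra.TensorProduct.map ρ ρ)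
  have hR : ∀ (s : Uq q ⊗[ℂ] Uq q) (a b : QPlane q), R s (a ⊗ₜ b) =
      TensorProduct.map (ρ.toLinearMap.flip a) (ρ.toLinearMap.flip b) s := by
    intro s a b
    induction s with
    | zero => simp
    | tmul u v => simp [R, Module.endTensorEndAlgHom_apply]
    | add u v hu hv => rw [map_add, LinearMap.add_apply, hu, hv, map_add]
  -- The module algebra axiom says that multiplication is equivariant. Stated for all tensors `t`,
  -- and not only for pure ones, it passes to products of elements `u`, so that generators suffice.
  have key : ∀ (u : Uq q) (t : QPlane q ⊗[ℂ] QPlane q),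
      ρ u (LinearMap.mul' ℂ _ t) = LinearMap.mul' ℂ _ (R (Coalgebra.comul u) t) := by
    intro u
    induction u using Uq.induction with
    | hs c =>
      intro t
      rw [Bialgebra.comul_algebraMap, AlgHom.commutes, AlgHom.commutes]
      simp [Algebra.algebraMap_eq_smul_one]
    | hg g =>
      intro t
      induction t with
      | zero => simp
      | tmul a b =>
        rw [hR, hρ, Uq.comul_gen]
        cases g
        · simp [Uq.comulGen, hρ, φ]
        · simp [Uq.comulGen, hρ, φ]
        · simp [Uq.comulGen, hρ, φ, T.E_mul _ _]
        · simp [Uq.comulGen, hρ, φ, T.F_mul _ _, add_comm]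
      | add t t' ht ht' => simp only [map_add, ht, ht']
    | hmul u v hu hv =>
      intro t
      rw [Bialgebra.comul_mul, map_mul, map_mul, Module.End.mul_apply, Module.End.mul_apply, hv, hu]
    | hadd u v hu hv =>
      intro t
      simp only [map_add, LinearMap.add_apply, hu, hv]
  have key1 : ∀ u : Uq q, ρ u 1 = Coalgebra.counit (R := ℂ) u • (1 : QPlane q) := by
    intro u
    induction u using Uq.induction with
    | hs c =>
      rw [AlgHom.commutes, Bialgebra.counit_algebraMap]
      simp [Algebra.algebraMap_eq_smul_one]
    | hg g =>
      rw [hρ, Uq.counit_gen]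
      cases g <;> simp [φ, Uq.counitGen, T.E_mul.map_one, T.F_mul.map_one]
    | hmul u v hu hv =>
      rw [map_mul, Module.End.mul_apply, hv, map_smul, hu, smul_smul, Bialgebra.counit_mul, mul_comm]
    | hadd u v hu hv => simp only [map_add, LinearMap.add_apply, hu, hv, add_smul]
  refine ⟨⟨ρ, fun u a b => ?_, key1⟩, ?_⟩
  · rw [← hR, ← key, LinearMap.mul'_apply]
  · simp [fullMatrix, SkewTriple.matrix, hρ, φ]

/-- The action of `k` is an algebra homomorphism, that of `k⁻¹` is its inverse, and those of `e` and
`f` are skew derivations for these. So all four are fixed by values on `x` and `y`. -/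
theorem eq_of_fullMatrix_eq {π π' : QPlaneAction q} (h : π.fullMatrix = π'.fullMatrix) :
    π = π' := by
  have h00 := congrFun₂ h 0 0
  have h01 := congrFun₂ h 0 1
  have h10 := congrFun₂ h 1 0
  have h11 := congrFun₂ h 1 1
  have h20 := congrFun₂ h 2 0
  have h21 := congrFun₂ h 2 1
  simp only [fullMatrix, Matrix.of_apply, Matrix.cons_val', Matrix.cons_val_zero,
    Matrix.cons_val_one, Matrix.cons_val, Matrix.cons_val_fin_one] at h00 h01 h10 h11 h20 h21
  have hk : π.kEquiv.toAlgHom = π'.kEquiv.toAlgHom := algHom_ext h00 h01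
  have hk' : π.toHom (Uq.gen q .k) = π'.toHom (Uq.gen q .k) :=
    LinearMap.ext fun a => AlgHom.congr_fun hk a
  have hkinv : π.toHom (Uq.gen q .kinv) = π'.toHom (Uq.gen q .kinv) := by
    refine LinearMap.ext fun a => ?_
    conv_lhs => rw [← π'.k_kinv a, ← hk', kinv_k]
  have he : π.toHom (Uq.gen q .e) = π'.toHom (Uq.gen q .e) := by
    refine IsSkewDer.ext (σ := AlgHom.id ℂ _) (τ := π.kEquiv.toAlgHom) (fun a b => π.gen_mul .e a b)
      (fun a b => ?_) h10 h11
    rw [hk]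
    exact π'.gen_mul .e a b
  have hf : π.toHom (Uq.gen q .f) = π'.toHom (Uq.gen q .f) := by
    refine IsSkewDer.ext (σ := π.kEquiv.symm.toAlgHom) (τ := AlgHom.id ℂ _)
      (fun a b => (π.gen_mul .f a b).trans (add_comm _ _)) (fun a b => ?_) h20 h21
    refine ((π'.gen_mul .f a b).trans (add_comm _ _)).trans ?_
    rw [← hkinv]
    rfl
  have hhom : π.toHom = π'.toHom := Uq.algHom_ext fun g => by
    cases g
    exacts [hk', hkinv, he, hf]
  cases π
  cases π'
  simp only at hhom
  subst hhom
  rfl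

/-! ### Isomorphisms preserve symbolic matrices. -/

theorem homogComp_diag (α β : ℂˣ) (i : ℕ) (p : QPlane q) :
    homogComp q i (diag α β p) = diag α β (homogComp q i p) := by
  have : homogComp q i ∘ₗ (diag α β).toLinearMap = (diag α β).toLinearMap ∘ₗ homogComp q i :=
    linear_ext fun m n => by
      simp only [LinearMap.comp_apply, AlgHom.toLinearMap_apply, diag_monomial, map_smul,
        homogComp_monomial]
      split_ifs
      · rw [diag_monomial]
      · simp
  exact LinearMap.congr_fun this p

theorem symb_of_homogComp_smul_diag (α β : ℂˣ) (c : ℂˣ) (i : ℕ) (p : QPlane q) :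
    Symb.of (homogComp q i ((c : ℂ) • diag α β p)) = Symb.of (homogComp q i p) := by
  have : homogComp q i ((c : ℂ) • diag α β p) = 0 ↔ homogComp q i p = 0 := by
    rw [map_smul, smul_eq_zero_iff_right c.ne_zero, homogComp_diag]
    exact map_eq_zero_iff _ (Function.LeftInverse.injective (diag_inv_diag α β))
  by_cases h : homogComp q i p = 0
  · rw [Symb.of, Symb.of, if_pos (this.2 h), if_pos h]
  · rw [Symb.of, Symb.of, if_neg (mt this.1 h), if_neg h]

/-- Isomorphic structures have the same symbolic matrices. -/
theorem symbMatrix_eq_of_isomorphic (hq : ∀ n : ℤ, n ≠ 0 → q ^ n ≠ 1) {π π' : QPlaneAction q}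
    (h : π.Isomorphic π') (i : ℕ) : π.symbMatrix i = π'.symbMatrix i := by
  obtain ⟨Ψ, hΨ⟩ := h
  obtain ⟨α, β, hα, hβ⟩ := algEquiv_x_y hq Ψ
  have hdiag : ∀ a, Ψ a = diag α β a := by
    have : Ψ.toAlgHom = diag α β := algHom_ext (by simpa using hα) (by simpa using hβ)
    exact AlgHom.congr_fun this
  have hx : ∀ u, π'.toHom u (x q) = ((α⁻¹ : ℂˣ) : ℂ) • diag α β (π.toHom u (x q)) := by
    intro u
    have h1 : Ψ.symm (x q) = ((α⁻¹ : ℂˣ) : ℂ) • x q := by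
      rw [AlgEquiv.symm_apply_eq, map_smul, hα, smul_smul, Units.inv_mul, one_smul]
    rw [← hΨ, h1, map_smul, map_smul, hdiag]
  have hy : ∀ u, π'.toHom u (y q) = ((β⁻¹ : ℂˣ) : ℂ) • diag α β (π.toHom u (y q)) := by
    intro u
    have h1 : Ψ.symm (y q) = ((β⁻¹ : ℂˣ) : ℂ) • y q := by
      rw [AlgEquiv.symm_apply_eq, map_smul, hβ, smul_smul, Units.inv_mul, one_smul]
    rw [← hΨ, h1, map_smul, map_smul, hdiag]
  ext r s
  fin_cases r <;> fin_cases s <;>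
    simp only [symbMatrix, efMatrix, Matrix.map_apply, Matrix.of_apply, Matrix.cons_val',
      Matrix.cons_val_zero, Matrix.cons_val_one, Matrix.cons_val_fin_one, Fin.zero_eta,
      Fin.mk_one, hx, hy, symb_of_homogComp_smul_diag]

end QPlaneAction

/-! ### Existence of the listed structures. -/

namespace SkewTriple

open QPlane

variable {q : ℂˣ}

theorem sub_inv_ne_zero (hq : ∀ n : ℤ, n ≠ 0 → q ^ n ≠ 1) : (q : ℂ) - (q : ℂ)⁻¹ ≠ 0 := by
  intro h
  have : (1 : ℤ) = -1 := zpow_injective hq (by simpa using sub_eq_zero.1 h)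
  omega

theorem sq_sub_one_ne_zero (hq : ∀ n : ℤ, n ≠ 0 → q ^ n ≠ 1) : (q : ℂ) ^ 2 - 1 ≠ 0 := by
  intro h
  have : (2 : ℤ) = 0 := zpow_injective hq (by simpa using sub_eq_zero.1 h)
  omega

/-- Together with `y_mul_x`, this brings right-nested products to the normal form with all `x`
before all `y`. -/
theorem y_mul_x_mul (p : QPlane q) : y q * (x q * p) = (q : ℂ) • (x q * (y q * p)) := by
  rw [← mul_assoc, y_mul_x, smul_mul_assoc, mul_assoc]

theorem exists_trivial (α β : ℂˣ) (hα : (α : ℂ) = 1 ∨ (α : ℂ) = -1)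
    (hβ : (β : ℂ) = 1 ∨ (β : ℂ) = -1) :
    ∃ T : SkewTriple q, T.matrix = !![(α : ℂ) • x q, (β : ℂ) • y q; 0, 0; 0, 0] := by
  apply exists_of_generators
  all_goals try simp only [map_zero, smul_zero, mul_zero, zero_mul, add_zero]
  intro E F _ _ _ _ _ _
  constructor
  · rcases hα with h | h <;> simp [h]
  · rcases hβ with h | h <;> simp [h]

theorem exists_standard (hq : ∀ n : ℤ, n ≠ 0 → q ^ n ≠ 1) {τ : ℂ} (hτ : τ ≠ 0) :
    ∃ T : SkewTriple q, T.matrix = !![(q : ℂ) • x q, (q : ℂ)⁻¹ • y q;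
      0, τ • x q; τ⁻¹ • y q, 0] := by
  have hq0 := q.ne_zero
  have hq1 := sub_inv_ne_zero hq
  have hq2 := sq_sub_one_ne_zero hq
  have := exists_of_generators q q⁻¹ 0 (τ • x q) (τ⁻¹ • y q) 0
    (by simp [smul_smul]) (by simp [smul_smul])
    (by simp)
    (by simp only [map_smul, diag_x, Units.val_inv_eq_inv_val]; match_scalars; field_simp)
    (by simp only [map_smul, diag_y, Units.val_inv_eq_inv_val]; match_scalars; field_simp)
    (by simp)
    (fun E F _ _ hEx hEy hFx hFy => by
      simp only [map_smul, map_zero, hEy, hFx, Units.val_inv_eq_inv_val]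
      constructor
      · match_scalars; field_simp
      · match_scalars; field_simp; ring)
  simpa using this

theorem exists_ey (hq : ∀ n : ℤ, n ≠ 0 → q ^ n ≠ 1) {b : ℂ} (hb : b ≠ 0) :
    ∃ T : SkewTriple q, T.matrix = !![(q : ℂ) • x q, ((q : ℂ) ^ 2)⁻¹ • y q;
      0, b • 1; b⁻¹ • (x q * y q), (-((q : ℂ) * b⁻¹)) • y q ^ 2] := by
  have hq0 := q.ne_zero
  have hq1 := sub_inv_ne_zero hq
  have hq2 := sq_sub_one_ne_zero hq
  have := exists_of_generators q (q ^ 2)⁻¹ 0 (b • 1) (b⁻¹ • (x q * y q))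
    ((-((q : ℂ) * b⁻¹)) • y q ^ 2)
    (by simp [smul_smul])
    (by
      simp only [pow_two (y q), mul_assoc, y_mul_x, y_mul_x_mul, smul_mul_assoc, mul_smul_comm,
        Units.val_inv_eq_inv_val, Units.val_pow_eq_pow_val]
      match_scalars
      field_simp
      ring)
    (by simp)
    (by simp only [map_smul, map_one, Units.val_inv_eq_inv_val, Units.val_pow_eq_pow_val]
        match_scalars; field_simp)
    (by simp only [map_smul, map_mul, diag_x, diag_y, smul_mul_assoc, mul_smul_comm,
          Units.val_inv_eq_inv_val, Units.val_pow_eq_pow_val]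
        match_scalars; field_simp)
    (by simp only [map_smul, pow_two (y q), map_mul, diag_y, smul_mul_assoc, mul_smul_comm,
          Units.val_inv_eq_inv_val, Units.val_pow_eq_pow_val]
        match_scalars; field_simp)
    (fun E F hE hF hEx hEy hFx hFy => by
      simp only [map_smul, map_zero, hE _ _, hF.map_one, pow_two (y q), hEx, hEy,
        AlgHom.id_apply, diag_y, smul_mul_assoc, mul_smul_comm, one_mul, mul_one, zero_mul,
        Units.val_inv_eq_inv_val, Units.val_pow_eq_pow_val]
      constructor
      · match_scalars; field_simp
      · match_scalars; field_simp; ring)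
  simpa using this

/-- The parameters `s` and `t` are free for three reasons: `y^3` and `y^4` have the weights required
of `f(y)` and `f(x)`, each solves the compatibility condition alone, and `e` kills `y`, so neither
contributes to `ef - fe`. -/
theorem exists_ex (hq : ∀ n : ℤ, n ≠ 0 → q ^ n ≠ 1) {a s t : ℂ} (ha : a ≠ 0) :
    ∃ T : SkewTriple q, T.matrix = !![((q : ℂ) ^ 2)⁻¹ • x q, (q : ℂ)⁻¹ • y q;
      a • 1, 0;
      (-((q : ℂ) * a⁻¹)) • x q ^ 2 + t • y q ^ 4,
        (-((q : ℂ) * a⁻¹)) • (x q * y q) + s • y q ^ 3] := by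
  have hq0 := q.ne_zero
  have hq1 := sub_inv_ne_zero hq
  have hq2 := sq_sub_one_ne_zero hq
  have := exists_of_generators (q ^ 2)⁻¹ q⁻¹ (a • 1) 0
    ((-((q : ℂ) * a⁻¹)) • x q ^ 2 + t • y q ^ 4)
    ((-((q : ℂ) * a⁻¹)) • (x q * y q) + s • y q ^ 3)
    (by simp [smul_smul])
    (by
      simp only [pow_succ, pow_zero, one_mul, add_mul, mul_add, mul_assoc, y_mul_x, y_mul_x_mul,
        smul_mul_assoc, mul_smul_comm, Units.val_inv_eq_inv_val, Units.val_mul]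
      match_scalars <;> field_simp)
    (by simp only [map_smul, map_one, Units.val_inv_eq_inv_val, Units.val_pow_eq_pow_val]
        match_scalars; field_simp)
    (by simp)
    (by simp only [pow_succ, pow_zero, one_mul, mul_assoc, map_add, map_smul, map_mul, diag_x,
          diag_y, smul_mul_assoc, mul_smul_comm, Units.val_inv_eq_inv_val, Units.val_mul]
        match_scalars <;> field_simp)
    (by simp only [pow_succ, pow_zero, one_mul, mul_assoc, map_add, map_smul, map_mul, diag_x,
          diag_y, smul_mul_assoc, mul_smul_comm, Units.val_inv_eq_inv_val, Units.val_mul]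
        match_scalars <;> field_simp)
    (fun E F hE hF hEx hEy hFx hFy => by
      simp only [pow_succ, pow_zero, map_add, map_smul, map_zero, hE _ _, hF.map_one,
        hEx, hEy, AlgHom.id_apply, diag_x, diag_y, smul_mul_assoc, mul_smul_comm, one_mul, mul_one,
        zero_mul, mul_zero, smul_zero,
        add_zero, Units.val_inv_eq_inv_val, Units.val_mul]
      constructor
      · match_scalars; field_simp; ring
      · match_scalars; field_simp; ring)
  simpa using this

theorem matrix_eq_iff {T : SkewTriple q} {α β : ℂ} {ex ey fx fy : QPlane q} :
    T.matrix = !![α • x q, β • y q; ex, ey; fx, fy] ↔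
      ((T.α : ℂ) = α ∧ (T.β : ℂ) = β) ∧
        (T.E (x q) = ex ∧ T.E (y q) = ey) ∧ T.F (x q) = fx ∧ T.F (y q) = fy := by
  have hx : (T.α : ℂ) • x q = α • x q ↔ (T.α : ℂ) = α := by
    refine ⟨fun h => ?_, fun h => by rw [h]⟩
    have := congrArg (fun p => coeffs p (1, 0)) h
    simpa [coeffs_x] using this
  have hy : (T.β : ℂ) • y q = β • y q ↔ (T.β : ℂ) = β := by
    refine ⟨fun h => ?_, fun h => by rw [h]⟩
    have := congrArg (fun p => coeffs p (0, 1)) h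
    simpa [coeffs_y] using this
  rw [matrix, ← Matrix.ext_iff]
  simp [Fin.forall_fin_succ, hx, hy]

/-- The full action matrix of the flipped triple. -/
theorem flip_matrix {T : SkewTriple q} {α β : ℂ} {ex ey fx fy : QPlane q}
    (h : T.matrix = !![α • x q, β • y q; ex, ey; fx, fy]) :
    T.flip.matrix = !![β⁻¹ • x q, α⁻¹ • y q; swap fy, swap fx; swap ey, swap ex] := by
  rw [matrix_eq_iff] at h ⊢
  simp [flip, h]

theorem exists_of_mem_fullMatrices (hq : ∀ n : ℤ, n ≠ 0 → q ^ n ≠ 1) (L : ListedSeries)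
    {M : Matrix (Fin 3) (Fin 2) (QPlane q)} (hM : M ∈ L.fullMatrices q) :
    ∃ T : SkewTriple q, T.matrix = M := by
  cases L with
  | trivial =>
    obtain ⟨α, β, hα, hβ, rfl⟩ := hM
    have hα0 : α ≠ 0 := by rcases hα with rfl | rfl <;> simp
    have hβ0 : β ≠ 0 := by rcases hβ with rfl | rfl <;> simp
    exact exists_trivial (Units.mk0 α hα0) (Units.mk0 β hβ0) hα hβ
  | standard =>
    obtain ⟨τ, hτ, rfl⟩ := hM
    exact exists_standard hq hτ
  | ey =>
    obtain ⟨b, hb, rfl⟩ := hM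
    exact exists_ey hq hb
  | fx =>
    obtain ⟨c, hc, rfl⟩ := hM
    -- The swap exchanges the constant terms of `e(y)` and `f(x)` and keeps the parameter.
    obtain ⟨T, hT⟩ := exists_ey hq hc
    refine ⟨T.flip, (flip_matrix hT).trans ?_⟩
    simp [swap_mul, swap_pow]
  | ex =>
    obtain ⟨a, s, t, ha, rfl⟩ := hM
    exact exists_ex hq ha
  | fy =>
    obtain ⟨d, s, t, hd, rfl⟩ := hM
    obtain ⟨T, hT⟩ := exists_ex hq hd (s := s) (t := t)
    refine ⟨T.flip, (flip_matrix hT).trans ?_⟩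
    simp [swap_mul, swap_pow]

end SkewTriple

/-! ### Symbolic matrices of the listed structures. -/

namespace QPlaneAction

open QPlane

variable {q : ℂˣ}

theorem homogComp_x_pow (i n : ℕ) : homogComp q i (x q ^ n) = if n = i then x q ^ n else 0 := by
  simpa using homogComp_monomial (q := q) i n 0

theorem homogComp_y_pow (i n : ℕ) : homogComp q i (y q ^ n) = if n = i then y q ^ n else 0 := by
  simpa using homogComp_monomial (q := q) i 0 n

theorem homogComp_x (i : ℕ) : homogComp q i (x q) = if 1 = i then x q else 0 := by
  simpa using homogComp_x_pow (q := q) i 1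

theorem homogComp_y (i : ℕ) : homogComp q i (y q) = if 1 = i then y q else 0 := by
  simpa using homogComp_y_pow (q := q) i 1

theorem homogComp_x_mul_y (i : ℕ) :
    homogComp q i (x q * y q) = if 2 = i then x q * y q else 0 := by
  simpa using homogComp_monomial (q := q) i 1 1

theorem homogComp_one (i : ℕ) : homogComp q i 1 = if 0 = i then 1 else 0 := by
  simpa using homogComp_monomial (q := q) i 0 0

theorem one_ne_zero' : (1 : QPlane q) ≠ 0 := by
  intro h
  have := coeffs_one (q := q)
  rw [h, map_zero] at this
  simpa using DFunLike.congr_fun this (0, 0)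

/-- Outside the standard series all nonconstant entries have degree at least 2. In particular the
terms with `s` and `t` have degree 3 or 4 and leave no trace in the symbolic matrices. -/
theorem mem_toSet_of_mem_fullMatrices (L : ListedSeries) {π : QPlaneAction q}
    (h : π.fullMatrix ∈ L.fullMatrices q) : π ∈ L.toSet q := by
  have key : ∀ {kx ky ex ey fx fy : QPlane q}, π.fullMatrix = !![kx, ky; ex, ey; fx, fy] →
      ∀ i, π.symbMatrix i = !![Symb.of (homogComp q i ex), Symb.of (homogComp q i ey);
        Symb.of (homogComp q i fx), Symb.of (homogComp q i fy)] := by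
    intro kx ky ex ey fx fy hM i
    rw [fullMatrix, ← Matrix.ext_iff] at hM
    simp [Fin.forall_fin_succ] at hM
    simp [symbMatrix, efMatrix, hM]
    ext r s
    fin_cases r <;> fin_cases s <;> rfl
  cases L with
  | trivial =>
    obtain ⟨α, β, -, -, hM⟩ := h
    constructor <;> rw [key hM] <;>
      simp [Symb.of, ListedSeries.symb0, ListedSeries.symb1]
  | standard =>
    obtain ⟨τ, hτ, hM⟩ := h
    constructor <;> rw [key hM] <;>
      simp [Symb.of, ListedSeries.symb0, ListedSeries.symb1, homogComp_x, homogComp_y, hτ,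
        x_ne_zero, y_ne_zero]
  | ey =>
    obtain ⟨b, hb, hM⟩ := h
    constructor <;> rw [key hM] <;>
      simp [Symb.of, ListedSeries.symb0, ListedSeries.symb1, homogComp_x_mul_y, homogComp_y_pow,
        homogComp_one, hb, one_ne_zero']
  | fx =>
    obtain ⟨c, hc, hM⟩ := h
    constructor <;> rw [key hM] <;>
      simp [Symb.of, ListedSeries.symb0, ListedSeries.symb1, homogComp_x_mul_y, homogComp_x_pow,
        homogComp_one, hc, one_ne_zero']
  | ex =>
    obtain ⟨a, s, t, ha, hM⟩ := h
    constructor <;> rw [key hM] <;>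
      simp [Symb.of, ListedSeries.symb0, ListedSeries.symb1, homogComp_x_mul_y, homogComp_x_pow,
        homogComp_y_pow, homogComp_one, ha, one_ne_zero']
  | fy =>
    obtain ⟨d, s, t, hd, hM⟩ := h
    constructor <;> rw [key hM] <;>
      simp [Symb.of, ListedSeries.symb0, ListedSeries.symb1, homogComp_x_mul_y, homogComp_x_pow,
        homogComp_y_pow, homogComp_one, hd, one_ne_zero']

end QPlaneAction

theorem ListedSeries.symb_injective {L L' : ListedSeries} (h0 : L.symb0 = L'.symb0)
    (h1 : L.symb1 = L'.symb1) : L = L' := by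
  have a := congrFun₂ h0 0 0
  have b := congrFun₂ h0 0 1
  have c := congrFun₂ h0 1 0
  have d := congrFun₂ h0 1 1
  have e := congrFun₂ h1 0 1
  cases L <;> cases L' <;> first | rfl | (exfalso; simp [symb0, symb1] at a b c d e)

/-! ### Coefficients of skew derivations. -/

namespace QPlane

variable {q : ℂˣ}

theorem diag_one : diag 1 1 = AlgHom.id ℂ (QPlane q) := AlgHom.ext diag_one_one

/-! ### Leading terms of skew derivations -/

section

variable {α₁ β₁ α₂ β₂ : ℂˣ} {D : QPlane q →ₗ[ℂ] QPlane q}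

/-- The relation between the coefficients of the values of a skew derivation on `x` and `y`. -/
theorem IsSkewDer.coeffs_rel (hD : IsSkewDer (diag α₁ β₁) (diag α₂ β₂) D) (m n : ℤ) :
    coeffs (D (x q)) (m + 1, n) * (β₁ * (q : ℂ) ^ m - β₂) =
      coeffs (D (y q)) (m, n + 1) * (α₁ - α₂ * (q : ℂ) ^ n) := by
  -- Compare the coefficients of `x^(m+1) y^(n+1)` in `D(yx) = q D(xy)`. A common factor `q`
  -- cancels.
  have h := congrArg (fun p => coeffs (D p) (m + 1, n + 1)) (y_mul_x (q := q))
  simp only [map_smul, hD _ _, diag_x, diag_y, smul_mul_assoc, mul_smul_comm, map_add,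
    Finsupp.smul_apply, Finsupp.add_apply, coeffs_x_mul, coeffs_mul_x, coeffs_y_mul, coeffs_mul_y,
    add_sub_cancel_right, zpow_add₀ q.ne_zero, zpow_one, smul_eq_mul] at h
  refine mul_left_cancel₀ q.ne_zero ?_
  linear_combination h

/-- The hypotheses say that on `x` and `y` the leading part of `D` is `w` times the inner skew
derivation `a ↦ z τ(a) - σ(a) z` with `z = x^m y^n` in the quantum torus, where `m` or `n` may be
`-1`. The conclusion is its value on `x^i y^j`. The predicted coefficient may be zero, which `TopAt`
allows. -/
theorem IsSkewDer.topAt_monomial (hD : IsSkewDer (diag α₁ β₁) (diag α₂ β₂) D)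
    {φ : ℤ × ℤ →+ ℝ} (hφ : Function.Injective φ) {m n : ℤ} {w : ℂ}
    (hx : TopAt φ (m + 1, n) (w * (α₂ * (q : ℂ) ^ n - α₁)) (D (x q)))
    (hy : TopAt φ (m, n + 1) (w * (β₂ - β₁ * (q : ℂ) ^ m)) (D (y q))) (i j : ℕ) :
    TopAt φ (i + m, j + n) (w * ((α₂ : ℂ) ^ i * (β₂ : ℂ) ^ j * (q : ℂ) ^ (n * i) -
      (α₁ : ℂ) ^ i * (β₁ : ℂ) ^ j * (q : ℂ) ^ (m * j))) (D (x q ^ i * y q ^ j)) := by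
  have hxi : ∀ i : ℕ, TopAt φ (i + m, n)
      (w * ((α₂ : ℂ) ^ i * (q : ℂ) ^ (n * i) - (α₁ : ℂ) ^ i)) (D (x q ^ i)) := by
    intro i
    induction i with
    | zero => simpa [hD.map_one] using TopAt.zero φ (m, n)
    | succ i ih =>
      rw [pow_succ (x q), hD, map_pow, diag_x, diag_x, smul_pow, smul_mul_assoc, mul_smul_comm]
      have h1 := ((by simpa using QPlane.topAt_monomial (q := q) φ i 0 :
        TopAt φ ((i : ℤ), 0) 1 (x q ^ i)).mul hφ hx).smul ((α₁ : ℂ) ^ i)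
      have h2 := (ih.mul hφ (topAt_x φ)).smul (α₂ : ℂ)
      refine ((h1.of_eq (g' := (((i + 1 : ℕ) : ℤ) + m, n)) ?_ rfl).add
        (h2.of_eq ?_ rfl)).of_eq rfl ?_
      · ext <;> push_cast <;> simp; ring
      · ext <;> push_cast <;> simp; ring
      · push_cast
        simp only [mul_add, zpow_add₀ q.ne_zero, mul_one, zero_mul, zpow_zero]
        ring
  have hyj : ∀ j : ℕ, TopAt φ (m, j + n)
      (w * ((β₂ : ℂ) ^ j - (β₁ : ℂ) ^ j * (q : ℂ) ^ (m * j))) (D (y q ^ j)) := by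
    intro j
    induction j with
    | zero => simpa [hD.map_one] using TopAt.zero φ (m, n)
    | succ j ih =>
      rw [pow_succ' (y q), hD, map_pow (diag α₂ β₂), diag_y, diag_y, smul_pow, smul_mul_assoc, mul_smul_comm]
      have h1 := ((topAt_y φ).mul hφ ih).smul (β₁ : ℂ)
      have h2 := (hy.mul hφ (by simpa using QPlane.topAt_monomial (q := q) φ 0 j :
        TopAt φ (0, (j : ℤ)) 1 (y q ^ j))).smul ((β₂ : ℂ) ^ j)
      refine ((h1.of_eq (g' := (m, ((j + 1 : ℕ) : ℤ) + n)) ?_ rfl).add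
        (h2.of_eq ?_ rfl)).of_eq rfl ?_
      · ext <;> push_cast <;> simp; ring
      · ext <;> push_cast <;> simp; ring
      · push_cast
        simp only [mul_add, zpow_add₀ q.ne_zero, mul_one, one_mul, mul_zero, zpow_zero]
        ring
  rw [hD, map_pow (diag α₁ β₁), map_pow (diag α₂ β₂), diag_x, diag_y, smul_pow, smul_pow, smul_mul_assoc, mul_smul_comm]
  have h1 := ((by simpa using QPlane.topAt_monomial (q := q) φ i 0 :
    TopAt φ ((i : ℤ), 0) 1 (x q ^ i)).mul hφ (hyj j)).smul ((α₁ : ℂ) ^ i)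
  have h2 := ((hxi i).mul hφ (by simpa using QPlane.topAt_monomial (q := q) φ 0 j :
    TopAt φ (0, (j : ℤ)) 1 (y q ^ j))).smul ((β₂ : ℂ) ^ j)
  refine ((h1.of_eq (g' := ((i : ℤ) + m, (j : ℤ) + n)) ?_ rfl).add
    (h2.of_eq ?_ rfl)).of_eq rfl ?_
  · ext <;> simp
  · ext <;> simp; ring
  · simp only [mul_zero, zero_mul, zpow_zero]
    ring

theorem IsSkewDer.topAt (hD : IsSkewDer (diag α₁ β₁) (diag α₂ β₂) D)
    {φ : ℤ × ℤ →+ ℝ} (hφ : Function.Injective φ) {m n : ℤ} {w : ℂ}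
    (hx : TopAt φ (m + 1, n) (w * (α₂ * (q : ℂ) ^ n - α₁)) (D (x q)))
    (hy : TopAt φ (m, n + 1) (w * (β₂ - β₁ * (q : ℂ) ^ m)) (D (y q)))
    {i j : ℤ} {c : ℂ} {p : QPlane q} (hp : TopAt φ (i, j) c p) :
    TopAt φ (i + m, j + n) (c * (w * ((α₂ : ℂ) ^ i * (β₂ : ℂ) ^ j * (q : ℂ) ^ (n * i) -
      (α₁ : ℂ) ^ i * (β₁ : ℂ) ^ j * (q : ℂ) ^ (m * j)))) (D p) :=
  TopAt.map (L := fun g => (g.1 + m, g.2 + n))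
    (κ := fun g => w * ((α₂ : ℂ) ^ g.1 * (β₂ : ℂ) ^ g.2 * (q : ℂ) ^ (n * g.1) -
      (α₁ : ℂ) ^ g.1 * (β₁ : ℂ) ^ g.2 * (q : ℂ) ^ (m * g.2))) hφ
    (fun h g hlt => by
      have : ∀ g : ℤ × ℤ, φ (g.1 + m, g.2 + n) = φ g + φ (m, n) := fun g => (φ.map_add g (m, n))
      rw [this, this]
      linarith)
    (fun i j => by simpa only [zpow_natCast] using hD.topAt_monomial hφ hx hy i j) hp

/-- The leading term of a nonzero skew derivation. -/
theorem IsSkewDer.exists_top (hD : IsSkewDer (diag α₁ β₁) (diag α₂ β₂) D) (φ : ℤ × ℤ →+ ℝ)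
    (hne : D ≠ 0)
    (hw : ∀ m n, coeffs (D (x q)) (m + 1, n) ≠ 0 ∨ coeffs (D (y q)) (m, n + 1) ≠ 0 →
      ¬ ((α₁ : ℂ) = α₂ * (q : ℂ) ^ n ∧ (β₁ : ℂ) * (q : ℂ) ^ m = β₂)) :
    ∃ m n w, (coeffs (D (x q)) (m + 1, n) ≠ 0 ∨ coeffs (D (y q)) (m, n + 1) ≠ 0) ∧ w ≠ 0 ∧
      (∀ i j, coeffs (D (x q)) (i + 1, j) ≠ 0 ∨ coeffs (D (y q)) (i, j + 1) ≠ 0 →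
        φ (i, j) ≤ φ (m, n)) ∧
      TopAt φ (m + 1, n) (w * (α₂ * (q : ℂ) ^ n - α₁)) (D (x q)) ∧
      TopAt φ (m, n + 1) (w * (β₂ - β₁ * (q : ℂ) ^ m)) (D (y q)) := by
  classical
  -- `S` is the set of exponent shifts that occur in `D(x)` or `D(y)`.
  let S : Finset (ℤ × ℤ) := (coeffs (D (x q))).support.image (fun g => (g.1 - 1, g.2)) ∪
    (coeffs (D (y q))).support.image (fun g => (g.1, g.2 - 1))
  have hS : ∀ i j, (i, j) ∈ S ↔
      (coeffs (D (x q)) (i + 1, j) ≠ 0 ∨ coeffs (D (y q)) (i, j + 1) ≠ 0) := by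
    intro i j
    simp only [S, Finset.mem_union, Finset.mem_image, Finsupp.mem_support_iff, Prod.mk.injEq,
      Prod.exists]
    constructor
    · rintro (⟨a, b, h, rfl, rfl⟩ | ⟨a, b, h, rfl, rfl⟩)
      · left; simpa using h
      · right; simpa using h
    · rintro (h | h)
      · exact Or.inl ⟨_, _, h, by ring, rfl⟩
      · exact Or.inr ⟨_, _, h, rfl, by ring⟩
  have hSne : S.Nonempty := by
    by_contra hS0
    rw [Finset.not_nonempty_iff_eq_empty] at hS0
    simp only [hS0, Finset.notMem_empty, false_iff, not_or, not_not] at hS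
    refine hne (hD.ext (isSkewDer_zero _ _) (ext_coeffs fun i j => ?_)
      (ext_coeffs fun i j => ?_))
    · simpa using (hS (i - 1) j).1
    · simpa using (hS i (j - 1)).2
  obtain ⟨⟨m, n⟩, hmn, hmax⟩ := Finset.exists_max_image S φ hSne
  rw [hS] at hmn
  have hmax' : ∀ i j, coeffs (D (x q)) (i + 1, j) ≠ 0 ∨ coeffs (D (y q)) (i, j + 1) ≠ 0 →
      φ (i, j) ≤ φ (m, n) := fun i j h => hmax _ ((hS i j).2 h)
  have hrel := hD.coeffs_rel m n
  -- `coeffs_rel` makes the two coefficients proportional to those of the inner skew derivation, and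
  -- `hw` ensures that the latter do not both vanish.
  obtain ⟨w, h1, h2⟩ : ∃ w : ℂ, coeffs (D (x q)) (m + 1, n) = w * (α₂ * (q : ℂ) ^ n - α₁) ∧
      coeffs (D (y q)) (m, n + 1) = w * (β₂ - β₁ * (q : ℂ) ^ m) := by
    by_cases h : (α₁ : ℂ) = α₂ * (q : ℂ) ^ n
    · have h' : (β₂ : ℂ) - β₁ * (q : ℂ) ^ m ≠ 0 := fun h0 =>
        hw m n hmn ⟨h, (sub_eq_zero.1 h0).symm⟩
      refine ⟨coeffs (D (y q)) (m, n + 1) / (β₂ - β₁ * (q : ℂ) ^ m), ?_, by field_simp⟩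
      field_simp
      linear_combination -hrel
    · have h' : (α₂ : ℂ) * (q : ℂ) ^ n - α₁ ≠ 0 := fun h0 => h (sub_eq_zero.1 h0).symm
      refine ⟨coeffs (D (x q)) (m + 1, n) / (α₂ * (q : ℂ) ^ n - α₁), by field_simp, ?_⟩
      field_simp
      linear_combination hrel
  have hφ1 : ∀ i j, φ (i + 1, j) = φ (i, j) + φ (1, 0) := fun i j => by
    rw [← map_add]; simp
  have hφ2 : ∀ i j, φ (i, j + 1) = φ (i, j) + φ (0, 1) := fun i j => by
    rw [← map_add]; simp
  refine ⟨m, n, w, hmn, ?_, hmax', ⟨h1, ?_⟩, ⟨h2, ?_⟩⟩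
  · rintro rfl
    rw [h1, h2] at hmn
    simp at hmn
  · rintro ⟨i, j⟩ h
    have := hmax' (i - 1) j (Or.inl (by simpa using h))
    have h3 := hφ1 (i - 1) j
    rw [sub_add_cancel] at h3
    rw [h3, hφ1]
    linarith
  · rintro ⟨i, j⟩ h
    have := hmax' i (j - 1) (Or.inr (by simpa using h))
    have h3 := hφ2 i (j - 1)
    rw [sub_add_cancel] at h3
    rw [h3, hφ2]
    linarith

/-! ### Lowest terms -/

/-- In degree at most 1 no `y` moves past an `x`, so the product does not see `q`. -/
theorem coeffs_mul_low (a b : QPlane q) :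
    coeffs (a * b) (0, 0) = coeffs a (0, 0) * coeffs b (0, 0) ∧
    coeffs (a * b) (1, 0) = coeffs a (0, 0) * coeffs b (1, 0) + coeffs a (1, 0) * coeffs b (0, 0) ∧
    coeffs (a * b) (0, 1) =
      coeffs a (0, 0) * coeffs b (0, 1) + coeffs a (0, 1) * coeffs b (0, 0) := by
  induction a using induction generalizing b with
  | hs c =>
    rw [Algebra.algebraMap_eq_smul_one]
    simp [coeffs_one]
  | hx =>
    have h1 : coeffs b (-1, 0) = 0 := coeffs_eq_zero (by simp) b
    have h2 : coeffs b (-1, 1) = 0 := coeffs_eq_zero (by simp) b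
    simp [coeffs_x_mul, coeffs_x, h1, h2]
  | hy =>
    have h1 : coeffs b (0, -1) = 0 := coeffs_eq_zero (by simp) b
    have h2 : coeffs b (1, -1) = 0 := coeffs_eq_zero (by simp) b
    simp [coeffs_y_mul, coeffs_y, h1, h2]
  | hmul a a' ha ha' =>
    rw [mul_assoc]
    obtain ⟨h1, h2, h3⟩ := ha (a' * b)
    obtain ⟨h4, h5, h6⟩ := ha' b
    obtain ⟨h7, h8, h9⟩ := ha a'
    refine ⟨?_, ?_, ?_⟩
    · rw [h1, h4, h7, mul_assoc]
    · rw [h2, h4, h5, h7, h8]; ring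
    · rw [h3, h4, h6, h7, h9]; ring
  | hadd a a' ha ha' =>
    simp only [add_mul, map_add, Finsupp.add_apply, ha b, ha' b, true_and]
    constructor <;> ring

/-- A derivation of the augmentation is determined by the linear terms. -/
theorem augmentation_derivation {ℓ : QPlane q →ₗ[ℂ] ℂ}
    (h : ∀ a b, ℓ (a * b) = coeffs a (0, 0) * ℓ b + ℓ a * coeffs b (0, 0)) (p : QPlane q) :
    ℓ p = coeffs p (1, 0) * ℓ (x q) + coeffs p (0, 1) * ℓ (y q) := by
  induction p using induction with
  | hs c =>
    have h1 := h 1 1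
    rw [mul_one, coeffs_one, Finsupp.single_eq_same, one_mul, mul_one] at h1
    rw [Algebra.algebraMap_eq_smul_one]
    simp [coeffs_one, left_eq_add.1 h1]
  | hx => simp [coeffs_x]
  | hy => simp [coeffs_y]
  | hmul a b ha hb =>
    rw [h, ha, hb, (coeffs_mul_low a b).2.1, (coeffs_mul_low a b).2.2]
    ring
  | hadd a b ha hb =>
    rw [map_add, ha, hb, map_add, Finsupp.add_apply, Finsupp.add_apply]
    ring

/-- The action on linear terms of a skew derivation that does not produce constant terms. -/
theorem IsSkewDer.coeffs_low (hD : IsSkewDer (diag α₁ β₁) (diag α₂ β₂) D)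
    (hx : coeffs (D (x q)) (0, 0) = 0) (hy : coeffs (D (y q)) (0, 0) = 0) (p : QPlane q) :
    coeffs (D p) (1, 0) =
      coeffs p (1, 0) * coeffs (D (x q)) (1, 0) + coeffs p (0, 1) * coeffs (D (y q)) (1, 0) ∧
    coeffs (D p) (0, 1) =
      coeffs p (1, 0) * coeffs (D (x q)) (0, 1) + coeffs p (0, 1) * coeffs (D (y q)) (0, 1) := by
  -- Diagonal automorphisms fix constant terms, so the constant term of `D p` is an augmentation
  -- derivation that vanishes on `x` and `y`. Once it is zero, the linear coefficients of `D p` are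
  -- augmentation derivations too.
  have h0 : ∀ p, coeffs (D p) (0, 0) = 0 := fun p => by
    have := augmentation_derivation (ℓ := Finsupp.lapply (R := ℂ) (0, 0) ∘ₗ coeffs ∘ₗ D)
      (fun a b => by simp [hD _ _, coeffs_mul_low, coeffs_diag]) p
    simpa [hx, hy] using this
  constructor
  · exact augmentation_derivation (ℓ := Finsupp.lapply (R := ℂ) (1, 0) ∘ₗ coeffs ∘ₗ D)
      (fun a b => by simp [hD _ _, coeffs_mul_low, coeffs_diag, h0]) p
  · exact augmentation_derivation (ℓ := Finsupp.lapply (R := ℂ) (0, 1) ∘ₗ coeffs ∘ₗ D)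
      (fun a b => by simp [hD _ _, coeffs_mul_low, coeffs_diag, h0]) p

end

end QPlane

/-! ### Classification of triples by weights. -/

namespace SkewTriple

open QPlane

variable {q : ℂˣ} (T : SkewTriple q)

theorem E_isSkewDer : IsSkewDer (diag 1 1) (diag T.α T.β) T.E := by
  rw [diag_one]
  exact T.E_mul

theorem F_isSkewDer : IsSkewDer (diag T.α⁻¹ T.β⁻¹) (diag 1 1) T.F := by
  rw [diag_one]
  exact T.F_mul

variable {T}

/-- The pair `(m, n)` is the shift of exponents from `x` or `y` to a monomial of its image. The
weight of `k` changes by `α^m β^n` under it, and `ke = q²ek` prescribes this change. -/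
theorem weight_E {m n : ℤ}
    (h : coeffs (T.E (x q)) (m + 1, n) ≠ 0 ∨ coeffs (T.E (y q)) (m, n + 1) ≠ 0) :
    (T.α : ℂ) ^ m * (T.β : ℂ) ^ n = (q : ℂ) ^ (2 : ℤ) := by
  have hα := T.α.ne_zero
  have hβ := T.β.ne_zero
  rcases h with h | h
  · have h1 := congrArg (fun p => coeffs p (m + 1, n)) (T.K_E (x q))
    simp only [coeffs_diag, diag_x, map_smul, Finsupp.smul_apply, smul_eq_mul] at h1
    refine mul_right_cancel₀ (mul_ne_zero h hα) ?_
    rw [zpow_add₀ hα, zpow_one] at h1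
    rw [zpow_ofNat]
    linear_combination h1
  · have h1 := congrArg (fun p => coeffs p (m, n + 1)) (T.K_E (y q))
    simp only [coeffs_diag, diag_y, map_smul, Finsupp.smul_apply, smul_eq_mul] at h1
    refine mul_right_cancel₀ (mul_ne_zero h hβ) ?_
    rw [zpow_add₀ hβ, zpow_one] at h1
    rw [zpow_ofNat]
    linear_combination h1

theorem weight_F {m n : ℤ}
    (h : coeffs (T.F (x q)) (m + 1, n) ≠ 0 ∨ coeffs (T.F (y q)) (m, n + 1) ≠ 0) :
    (T.α : ℂ) ^ m * (T.β : ℂ) ^ n = (q : ℂ) ^ (-2 : ℤ) := by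
  have hα := T.α.ne_zero
  have hβ := T.β.ne_zero
  rcases h with h | h
  · have h1 := congrArg (fun p => coeffs p (m + 1, n)) (T.K_F (x q))
    simp only [coeffs_diag, diag_x, map_smul, Finsupp.smul_apply, smul_eq_mul] at h1
    refine mul_right_cancel₀ (mul_ne_zero h hα) ?_
    rw [zpow_add₀ hα, zpow_one] at h1
    linear_combination h1
  · have h1 := congrArg (fun p => coeffs p (m, n + 1)) (T.K_F (y q))
    simp only [coeffs_diag, diag_y, map_smul, Finsupp.smul_apply, smul_eq_mul] at h1
    refine mul_right_cancel₀ (mul_ne_zero h hβ) ?_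
    rw [zpow_add₀ hβ, zpow_one] at h1
    linear_combination h1

theorem coeffs_E_rel (m n : ℤ) : coeffs (T.E (x q)) (m + 1, n) * ((q : ℂ) ^ m - T.β) =
    coeffs (T.E (y q)) (m, n + 1) * (1 - T.α * (q : ℂ) ^ n) := by
  simpa using T.E_isSkewDer.coeffs_rel m n

theorem coeffs_F_rel (m n : ℤ) :
    coeffs (T.F (x q)) (m + 1, n) * ((T.β : ℂ)⁻¹ * (q : ℂ) ^ m - 1) =
      coeffs (T.F (y q)) (m, n + 1) * ((T.α : ℂ)⁻¹ - (q : ℂ) ^ n) := by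
  simpa using T.F_isSkewDer.coeffs_rel m n

theorem E_F_x : T.E (T.F (x q)) - T.F (T.E (x q)) =
    (((q : ℂ) - (q : ℂ)⁻¹)⁻¹ * (T.α - (T.α : ℂ)⁻¹)) • x q := by
  rw [T.E_F, diag_x, diag_x, Units.val_inv_eq_inv_val, ← sub_smul, smul_smul]

theorem E_F_y : T.E (T.F (y q)) - T.F (T.E (y q)) =
    (((q : ℂ) - (q : ℂ)⁻¹)⁻¹ * (T.β - (T.β : ℂ)⁻¹)) • y q := by
  rw [T.E_F, diag_y, diag_y, Units.val_inv_eq_inv_val, ← sub_smul, smul_smul]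

theorem sq_eq_one_of_sub_inv {z : ℂˣ} (h : (z : ℂ) - (z : ℂ)⁻¹ = 0) : (z : ℂ) ^ 2 = 1 := by
  have hz := z.ne_zero
  field_simp at h
  linear_combination h

theorem E_ne_zero_and_F_ne_zero (hq : ∀ n : ℤ, n ≠ 0 → q ^ n ≠ 1) (hα : (T.α : ℂ) ^ 2 ≠ 1) :
    T.E ≠ 0 ∧ T.F ≠ 0 := by
  have key : T.E (T.F (x q)) - T.F (T.E (x q)) ≠ 0 := by
    rw [E_F_x]
    exact smul_ne_zero (mul_ne_zero (inv_ne_zero (sub_inv_ne_zero hq))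
      fun h => hα (sq_eq_one_of_sub_inv h)) x_ne_zero
  constructor <;> intro h <;> exact key (by simp [h])

/-! ### Vanishing of the action -/

/-- All products `α^m β^n` square to 1 and `q^(±2)` does not, so no monomial can occur in the
`ef`-matrix. -/
theorem matrix_of_sq_eq_one (hq : ∀ n : ℤ, n ≠ 0 → q ^ n ≠ 1) (hα : (T.α : ℂ) ^ 2 = 1)
    (hβ : (T.β : ℂ) ^ 2 = 1) : T.matrix ∈ ListedSeries.trivial.fullMatrices q := by
  have hw : ∀ (m n k : ℤ), k ≠ 0 → (T.α : ℂ) ^ m * (T.β : ℂ) ^ n ≠ (q : ℂ) ^ k := by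
    intro m n k hk h
    have h2 : ((q : ℂ) ^ k) ^ 2 = 1 := by
      rw [← h, mul_pow, ← zpow_natCast, ← zpow_natCast, ← zpow_mul, ← zpow_mul, mul_comm m,
        mul_comm n, zpow_mul, zpow_mul, zpow_natCast, zpow_natCast, hα, hβ, one_zpow, one_zpow,
        one_mul]
    have h3 : k * 2 = 0 := zpow_injective hq (by
      rw [zpow_mul, zpow_zero]
      exact_mod_cast h2)
    omega
  have h2 : (2 : ℤ) ≠ 0 := by norm_num
  have h2' : (-2 : ℤ) ≠ 0 := by norm_num
  refine ⟨T.α, T.β, sq_eq_one_iff.1 hα, sq_eq_one_iff.1 hβ,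
    matrix_eq_iff.2 ⟨⟨rfl, rfl⟩, ⟨?_, ?_⟩, ?_, ?_⟩⟩
  all_goals refine ext_coeffs fun i j => ?_
  all_goals by_contra h; rw [map_zero, Finsupp.zero_apply] at h
  · exact hw (i - 1) j 2 h2 (weight_E (.inl (by simpa using h)))
  · exact hw i (j - 1) 2 h2 (weight_E (.inr (by simpa using h)))
  · exact hw (i - 1) j _ h2' (weight_F (.inl (by simpa using h)))
  · exact hw i (j - 1) _ h2' (weight_F (.inr (by simpa using h)))

/-! ### The infinite families of weights -/

/-- Comparison of the leading terms of both sides of `ef - fe = (k - k⁻¹) / (q - q⁻¹)`. -/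
theorem top_E_F {φ : ℤ × ℤ →+ ℝ} (hφ : Function.Injective φ) {m n m' n' : ℤ} {w v : ℂ}
    (hw : w ≠ 0) (hv : v ≠ 0) (hwE : (T.α : ℂ) ^ m * (T.β : ℂ) ^ n = (q : ℂ) ^ (2 : ℤ))
    (hwF : (T.α : ℂ) ^ m' * (T.β : ℂ) ^ n' = (q : ℂ) ^ (-2 : ℤ))
    (hEx : TopAt φ (m + 1, n) (w * (T.α * (q : ℂ) ^ n - (1 : ℂˣ))) (T.E (x q)))
    (hEy : TopAt φ (m, n + 1) (w * (T.β - (1 : ℂˣ) * (q : ℂ) ^ m)) (T.E (y q)))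
    (hFx : TopAt φ (m' + 1, n') (v * ((1 : ℂˣ) * (q : ℂ) ^ n' - (T.α⁻¹ : ℂˣ))) (T.F (x q)))
    (hFy : TopAt φ (m', n' + 1) (v * ((1 : ℂˣ) - (T.β⁻¹ : ℂˣ) * (q : ℂ) ^ m')) (T.F (y q)))
    (hne : n + n' ≠ 0) :
    (q : ℂ) ^ (n * m' - 2) = (q : ℂ) ^ (m * n') ∨
      (T.α : ℂ) * (q : ℂ) ^ n * (q : ℂ) ^ n' = (T.α : ℂ)⁻¹ := by
  have hα := T.α.ne_zero
  have h1 := T.E_isSkewDer.topAt hφ hEx hEy hFx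
  have h2 := T.F_isSkewDer.topAt hφ hFx hFy hEx
  have h := (h1.of_eq (g' := (m + m' + 1, n + n')) (by ext <;> simp <;> ring) rfl).1.symm
  have h' := (h2.of_eq (g' := (m + m' + 1, n + n')) (by ext <;> simp <;> ring) rfl).1.symm
  have h3 := congrArg (fun p => coeffs p (m + m' + 1, n + n')) (T.E_F_x)
  simp only [map_sub, Finsupp.sub_apply, ← h, ← h', map_smul, Finsupp.smul_apply, coeffs_x] at h3
  -- The right side of the relation is a multiple of `x`, which has no term with `y`-exponent `n +
  -- n' ≠ 0`.
  rw [Finsupp.single_eq_of_ne (by simp [hne]), smul_zero] at h3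
  have e1 : (T.α : ℂ) ^ (m' + 1) * (T.β : ℂ) ^ n' = T.α * (q : ℂ) ^ (-2 : ℤ) := by
    rw [← hwF, zpow_add₀ hα, zpow_one]
    ring
  have e2 : ((T.α : ℂ)⁻¹) ^ (m + 1) * ((T.β : ℂ)⁻¹) ^ n = (T.α : ℂ)⁻¹ * (q : ℂ) ^ (-2 : ℤ) := by
    rw [zpow_neg, ← hwE, inv_zpow, inv_zpow, zpow_add₀ hα, zpow_one, mul_inv, mul_inv]
    ring
  simp only [Units.val_one, one_zpow, one_mul, Units.val_inv_eq_inv_val, e1, e2] at h3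
  have e3 : (q : ℂ) ^ (n * m' - 2) = (q : ℂ) ^ (-2 : ℤ) * (q : ℂ) ^ (n * m') := by
    rw [← zpow_add₀ q.ne_zero]
    ring_nf
  have e4 : (q : ℂ) ^ (n * (m' + 1)) = (q : ℂ) ^ (n * m') * (q : ℂ) ^ n := by
    rw [← zpow_add₀ q.ne_zero]
    ring_nf
  have e5 : (q : ℂ) ^ (n' * (m + 1)) = (q : ℂ) ^ (m * n') * (q : ℂ) ^ n' := by
    rw [← zpow_add₀ q.ne_zero]
    ring_nf
  rw [e4, e5, mul_comm m' n] at h3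
  rw [e3]
  -- After substitution of the weights the four mixed products cancel in part, and the difference of
  -- the two leading coefficients factors.
  have h4 : (w * v) * (((q : ℂ) ^ (-2 : ℤ) * (q : ℂ) ^ (n * m') - (q : ℂ) ^ (m * n')) *
      ((T.α : ℂ) * (q : ℂ) ^ n * (q : ℂ) ^ n' - (T.α : ℂ)⁻¹)) = 0 := by
    linear_combination h3
  rcases mul_eq_zero.1 ((mul_eq_zero.1 h4).resolve_left (mul_ne_zero hw hv)) with h5 | h5
  · exact .inl (sub_eq_zero.1 h5)
  · exact .inr (sub_eq_zero.1 h5)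

/-- If `k` acts by `q` and `q ^ (-t)` with `t > 0`, then each entry of the `ef`-matrix is a multiple
of one monomial. -/
theorem coeffs_of_weights (hq : ∀ n : ℤ, n ≠ 0 → q ^ n ≠ 1) {t : ℤ} (ht : 0 < t)
    (hα : (T.α : ℂ) = q) (hβ : (T.β : ℂ) = (q : ℂ) ^ (-t)) :
    (∀ i j, coeffs (T.E (x q)) (i, j) = 0) ∧
    (∀ i j, (i, j) ≠ (2 - t, 0) → coeffs (T.E (y q)) (i, j) = 0) ∧
    (∀ i j, (i, j) ≠ (t - 1, 1) → coeffs (T.F (x q)) (i, j) = 0) ∧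
    (∀ i j, (i, j) ≠ (t - 2, 2) → coeffs (T.F (y q)) (i, j) = 0) := by
  have hαβ : ∀ m n : ℤ, (T.α : ℂ) ^ m * (T.β : ℂ) ^ n = (q : ℂ) ^ (m - t * n) := fun m n => by
    rw [hα, hβ, ← zpow_mul, ← zpow_add₀ q.ne_zero]
    ring_nf
  have hα2 : (T.α : ℂ) ^ 2 ≠ 1 := fun h => by
    rw [hα] at h
    exact sq_sub_one_ne_zero hq (sub_eq_zero.2 h)
  have wE : ∀ m n : ℤ, coeffs (T.E (x q)) (m + 1, n) ≠ 0 ∨ coeffs (T.E (y q)) (m, n + 1) ≠ 0 →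
      m - t * n = 2 ∧ -1 ≤ n := by
    intro m n h
    refine ⟨zpow_injective hq ((hαβ m n).symm.trans (weight_E h)), ?_⟩
    rcases h with h | h <;> have := nonneg_of_coeffs_ne_zero h <;> simp only at this <;> omega
  -- The bound `1 ≤ n` comes from `tn = m + 2 ≥ 1` and `t > 0`.
  have wF : ∀ m n : ℤ, coeffs (T.F (x q)) (m + 1, n) ≠ 0 ∨ coeffs (T.F (y q)) (m, n + 1) ≠ 0 →
      m - t * n = -2 ∧ 1 ≤ n := by
    intro m n h
    have h1 : m - t * n = -2 := zpow_injective hq ((hαβ m n).symm.trans (weight_F h))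
    have h2 : -1 ≤ m := by
      rcases h with h | h <;> have := nonneg_of_coeffs_ne_zero h <;> simp only at this <;> omega
    refine ⟨h1, ?_⟩
    by_contra hn
    nlinarith
  obtain ⟨hE0, hF0⟩ := E_ne_zero_and_F_ne_zero hq hα2
  obtain ⟨m, n, w, hmn, hw, hmax, hEx, hEy⟩ := T.E_isSkewDer.exists_top slope hE0
    (fun m n h ⟨h1, h2⟩ => by
      have h3 := (wE m n h).1
      rw [hα, Units.val_one, ← zpow_one_add₀ q.ne_zero] at h1
      rw [hβ, Units.val_one, one_mul] at h2
      have h4 : (0 : ℤ) = 1 + n := zpow_injective hq (by simpa using h1)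
      have h5 := zpow_injective hq h2
      rw [h5, show n = -1 by omega] at h3
      omega)
  obtain ⟨m', n', v, hmn', hv, hmax', hFx, hFy⟩ := T.F_isSkewDer.exists_top slope hF0
    (fun m n h ⟨h1, h2⟩ => by
      have h3 := (wF m n h)
      rw [Units.val_inv_eq_inv_val, hα, Units.val_one, one_mul, ← zpow_neg_one] at h1
      have h4 : -1 = n := zpow_injective hq h1
      omega)
  obtain ⟨a1, a2⟩ := wE m n hmn
  obtain ⟨b1, b2⟩ := wF m' n' hmn'
  -- Otherwise `top_E_F` forces `n + n' = -1` or `n + n' = -2`, against `n ≥ -1` and `n' ≥ 1`. So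
  -- the top shifts have the least `y`-components that are allowed.
  have hnn : n + n' = 0 := by
    by_contra hne
    rcases top_E_F slope_injective hw hv (weight_E hmn) (weight_F hmn') hEx hEy hFx hFy hne with
      h | h
    · have h1 := zpow_injective hq h
      have h2 : n * m' - 2 - m * n' = -2 * (n + n' + 1) := by
        linear_combination n * b1 - n' * a1
      omega
    · rw [hα, ← zpow_one_add₀ q.ne_zero, ← zpow_add₀ q.ne_zero, ← zpow_neg_one] at h
      have h1 := zpow_injective hq h
      omega
  obtain ⟨rfl, rfl⟩ : n = -1 ∧ n' = 1 := by omega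
  have ht' : (0 : ℝ) < t := by exact_mod_cast ht
  have h2 : 0 < Real.sqrt 2 := by positivity
  -- Along the line `i = 2 + tj` of admissible shifts `slope` grows with `j`. The top shift is at
  -- the minimum `j = -1`, hence no other shift occurs. The argument for `F` is the same with
  -- minimum `j = 1`.
  have cE : ∀ i j : ℤ, coeffs (T.E (x q)) (i + 1, j) ≠ 0 ∨ coeffs (T.E (y q)) (i, j + 1) ≠ 0 →
      j = -1 ∧ i = 2 - t := by
    intro i j h
    obtain ⟨c1, c2⟩ := wE i j h
    have h1 := hmax i j h
    rw [slope_apply, slope_apply] at h1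
    have hi : (i : ℝ) = 2 + t * j := by exact_mod_cast (by linarith : i = 2 + t * j)
    have hm : (m : ℝ) = 2 - t := by exact_mod_cast (by linarith : m = 2 - t)
    have hj : j = -1 := by
      by_contra hj
      have : (0 : ℝ) ≤ j := by exact_mod_cast (by omega : 0 ≤ j)
      simp only [hi, hm] at h1
      push_cast at h1
      nlinarith [mul_nonneg ht'.le this, mul_nonneg h2.le this]
    subst hj
    exact ⟨rfl, by linarith⟩
  have cF : ∀ i j : ℤ, coeffs (T.F (x q)) (i + 1, j) ≠ 0 ∨ coeffs (T.F (y q)) (i, j + 1) ≠ 0 →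
      j = 1 ∧ i = t - 2 := by
    intro i j h
    obtain ⟨c1, c2⟩ := wF i j h
    have h1 := hmax' i j h
    rw [slope_apply, slope_apply] at h1
    have hi : (i : ℝ) = -2 + t * j := by exact_mod_cast (by linarith : i = -2 + t * j)
    have hm : (m' : ℝ) = t - 2 := by exact_mod_cast (by linarith : m' = t - 2)
    have hj : j = 1 := by
      by_contra hj
      have : (0 : ℝ) < j - 1 := by
        have : (1 : ℝ) < j := by exact_mod_cast (by omega : 1 < j)
        linarith
      simp only [hi, hm] at h1
      push_cast at h1
      nlinarith [mul_pos ht' this, mul_pos h2 this]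
    subst hj
    exact ⟨rfl, by linarith⟩
  refine ⟨fun i j => ?_, fun i j hij => ?_, fun i j hij => ?_, fun i j hij => ?_⟩
  · by_contra h
    have h1 := nonneg_of_coeffs_ne_zero h
    have h2 := cE (i - 1) j (.inl (by simpa using h))
    simp only at h1
    omega
  · by_contra h
    have h2 := cE i (j - 1) (.inr (by simpa using h))
    exact hij (Prod.ext h2.2 (by simp only; omega))
  · by_contra h
    have h2 := cF (i - 1) j (.inl (by simpa using h))
    exact hij (Prod.ext (by simp only; omega) h2.1)
  · by_contra h
    have h2 := cF i (j - 1) (.inr (by simpa using h))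
    exact hij (Prod.ext h2.2 (by simp only; omega))

theorem eq_smul_monomial {p : QPlane q} {m n : ℕ}
    (h : ∀ i j : ℤ, (i, j) ≠ ((m : ℤ), (n : ℤ)) → coeffs p (i, j) = 0) :
    p = coeffs p (m, n) • (x q ^ m * y q ^ n) := by
  refine ext_coeffs fun i j => ?_
  rw [map_smul, coeffs_monomial, Finsupp.smul_apply]
  by_cases hij : (i, j) = ((m : ℤ), (n : ℤ))
  · rw [hij, Finsupp.single_eq_same, smul_eq_mul, mul_one]
  · rw [h i j hij, Finsupp.single_eq_of_ne hij, smul_zero]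

theorem matrix_of_weights_standard (hq : ∀ n : ℤ, n ≠ 0 → q ^ n ≠ 1) (hα : (T.α : ℂ) = q)
    (hβ : (T.β : ℂ) = (q : ℂ)⁻¹) : T.matrix ∈ ListedSeries.standard.fullMatrices q := by
  obtain ⟨h1, h2, h3, h4⟩ := coeffs_of_weights hq one_pos hα (by rw [hβ, zpow_neg_one])
  have hEx : T.E (x q) = 0 := ext_coeffs fun i j => by rw [h1, map_zero, Finsupp.zero_apply]
  have hEy := eq_smul_monomial (m := 1) (n := 0) (p := T.E (y q)) (by simpa using h2)
  have hFx := eq_smul_monomial (m := 0) (n := 1) (p := T.F (x q)) (by simpa using h3)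
  have hFy : T.F (y q) = 0 := ext_coeffs fun i j => by
    rw [map_zero, Finsupp.zero_apply]
    -- For `t = 1` the only candidate in `f(y)` is `x⁻¹y²`, which is not in the plane.
    by_cases hij : (i, j) = (1 - 2, 2)
    · rw [hij]
      exact coeffs_eq_zero (by simp) _
    · exact h4 i j hij
  rw [pow_one, pow_zero, mul_one] at hEy
  rw [pow_one, pow_zero, one_mul] at hFx
  set τ := coeffs (T.E (y q)) ((1 : ℕ), (0 : ℕ))
  set τ' := coeffs (T.F (x q)) ((0 : ℕ), (1 : ℕ))
  have h := congrArg (fun p => coeffs p (1, 0)) (T.E_F_x)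
  simp only [hEx, hFx, hEy, hα, map_smul, map_zero, sub_zero, Finsupp.smul_apply, coeffs_x,
    Finsupp.single_eq_same, inv_mul_cancel₀ (sub_inv_ne_zero hq), smul_eq_mul, mul_one] at h
  exact ⟨τ, right_ne_zero_of_mul_eq_one h, matrix_eq_iff.2 ⟨⟨hα, hβ⟩, ⟨hEx, hEy⟩,
    by rw [hFx, eq_inv_of_mul_eq_one_left h], hFy⟩⟩

/-- For `t = 2` one coefficient is left in each of `e(y)`, `f(x)` and `f(y)`. The relation for `ef -
fe` on `x` makes the first two inverse to each other, and `coeffs_F_rel` at the shift `(0, 1)` gives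
the third. -/
theorem matrix_of_weights_ey (hq : ∀ n : ℤ, n ≠ 0 → q ^ n ≠ 1) (hα : (T.α : ℂ) = q)
    (hβ : (T.β : ℂ) = ((q : ℂ) ^ 2)⁻¹) : T.matrix ∈ ListedSeries.ey.fullMatrices q := by
  obtain ⟨h1, h2, h3, h4⟩ := coeffs_of_weights hq two_pos hα
    (by rw [hβ, zpow_neg, zpow_ofNat])
  have hrel := coeffs_F_rel (T := T) 0 1
  have hEx : T.E (x q) = 0 := ext_coeffs fun i j => by rw [h1, map_zero, Finsupp.zero_apply]
  have hEy := eq_smul_monomial (m := 0) (n := 0) (p := T.E (y q)) (by simpa using h2)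
  have hFx := eq_smul_monomial (m := 1) (n := 1) (p := T.F (x q)) (by simpa using h3)
  have hFy := eq_smul_monomial (m := 0) (n := 2) (p := T.F (y q)) (by simpa using h4)
  rw [pow_zero, pow_zero, one_mul] at hEy
  rw [pow_one, pow_one] at hFx
  rw [pow_zero, one_mul] at hFy
  set b := coeffs (T.E (y q)) ((0 : ℕ), (0 : ℕ))
  set c := coeffs (T.F (x q)) ((1 : ℕ), (1 : ℕ)) with hc
  set d := coeffs (T.F (y q)) ((0 : ℕ), (2 : ℕ)) with hd
  have h := congrArg (fun p => coeffs p (1, 0)) (T.E_F_x)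
  simp only [hEx, hFx, hEy, hα, map_smul, map_zero, sub_zero, Finsupp.smul_apply, coeffs_x,
    T.E_mul _ _, AlgHom.id_apply, zero_mul, add_zero, mul_smul_comm, mul_one,
    Finsupp.single_eq_same, inv_mul_cancel₀ (sub_inv_ne_zero hq), smul_eq_mul, mul_one] at h
  have hrel' : c * ((q : ℂ) ^ 2 - 1) = d * ((q : ℂ)⁻¹ - q) := by
    simpa [hα, hβ, hc, hd] using hrel
  have hcb := eq_inv_of_mul_eq_one_left h
  have hdc : d = -((q : ℂ) * b⁻¹) := by
    have hq0 := q.ne_zero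
    have hq2 := sq_sub_one_ne_zero hq
    rw [← hcb]
    refine mul_right_cancel₀ hq2 ?_
    field_simp at hrel'
    linear_combination hrel'
  exact ⟨b, right_ne_zero_of_mul_eq_one h, matrix_eq_iff.2 ⟨⟨hα, hβ⟩, ⟨hEx, hEy⟩,
    by rw [hFx, hcb], by rw [hFy, hdc]⟩⟩

/-- Both weights are negative powers of `q`, so a weight equation admits finitely many exponents:
`2i + j = 4` in `f(x)`, `2i + j = 3` in `f(y)`, `2i + j = 0` in `e(x)`, and none in `e(y)`. -/
theorem matrix_of_weights_ex (hq : ∀ n : ℤ, n ≠ 0 → q ^ n ≠ 1)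
    (hα : (T.α : ℂ) = ((q : ℂ) ^ 2)⁻¹) (hβ : (T.β : ℂ) = (q : ℂ)⁻¹) :
    T.matrix ∈ ListedSeries.ex.fullMatrices q := by
  have hq0 := q.ne_zero
  have hq2 := sq_sub_one_ne_zero hq
  have hαβ : ∀ m n : ℤ, (T.α : ℂ) ^ m * (T.β : ℂ) ^ n = (q : ℂ) ^ (-2 * m - n) := fun m n => by
    rw [hα, hβ, ← zpow_neg_one, ← zpow_neg_one, ← zpow_natCast, ← zpow_mul, ← zpow_mul,
      ← zpow_mul, ← zpow_add₀ hq0]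
    ring_nf
  have wE : ∀ m n : ℤ, coeffs (T.E (x q)) (m + 1, n) ≠ 0 ∨ coeffs (T.E (y q)) (m, n + 1) ≠ 0 →
      -2 * m - n = 2 := fun m n h => zpow_injective hq ((hαβ m n).symm.trans (weight_E h))
  have wF : ∀ m n : ℤ, coeffs (T.F (x q)) (m + 1, n) ≠ 0 ∨ coeffs (T.F (y q)) (m, n + 1) ≠ 0 →
      -2 * m - n = -2 := fun m n h => zpow_injective hq ((hαβ m n).symm.trans (weight_F h))
  have hEx := eq_smul_monomial (m := 0) (n := 0) (p := T.E (x q)) (fun i j hij => by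
    by_contra h
    have h1 := nonneg_of_coeffs_ne_zero h
    have h2 := wE (i - 1) j (.inl (by simpa using h))
    simp only [ne_eq, Prod.mk.injEq] at h1 hij
    omega)
  have hEy : T.E (y q) = 0 := ext_coeffs fun i j => by
    by_contra h
    rw [map_zero, Finsupp.zero_apply] at h
    have h1 := nonneg_of_coeffs_ne_zero h
    have h2 := wE i (j - 1) (.inr (by simpa using h))
    simp only at h1
    omega
  -- The monomial `xy²` has an admissible weight. It is excluded by compatibility at the shift `(0,
  -- 2)`, where the factor of `f(y)` vanishes and that of `f(x)` is `q - 1`.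
  have hc12 : coeffs (T.F (x q)) (1, 2) = 0 := by
    have := coeffs_F_rel (T := T) 0 2
    simp only [hα, hβ, inv_inv, zpow_ofNat, sub_self, mul_zero] at this
    rw [zero_add] at this
    refine (mul_eq_zero.1 this).resolve_right fun h => hq2 ?_
    linear_combination ((q : ℂ) + 1) * h
  have hcd : coeffs (T.F (x q)) (2, 0) = coeffs (T.F (y q)) (1, 1) := by
    have := coeffs_F_rel (T := T) 1 0
    simp only [hα, hβ, inv_inv, zpow_zero, zpow_one] at this
    refine mul_right_cancel₀ hq2 ?_
    norm_num at this
    linear_combination this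
  set a := coeffs (T.E (x q)) ((0 : ℕ), (0 : ℕ))
  rw [pow_zero, pow_zero, one_mul] at hEx
  set c := coeffs (T.F (x q)) (2, 0) with hc
  have hFx : T.F (x q) = c • x q ^ 2 + coeffs (T.F (x q)) (0, 4) • y q ^ 4 := by
    have e1 : coeffs (x q ^ 2) = Finsupp.single (2, 0) 1 := by
      simpa using coeffs_monomial (q := q) 2 0
    have e2 : coeffs (y q ^ 4) = Finsupp.single (0, 4) 1 := by
      simpa using coeffs_monomial (q := q) 0 4
    refine ext_coeffs fun i j => ?_
    rw [map_add, map_smul, map_smul, Finsupp.add_apply, Finsupp.smul_apply, Finsupp.smul_apply, e1,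
      e2]
    by_cases h0 : coeffs (T.F (x q)) (i, j) = 0
    · rw [h0]
      by_cases h20 : (i, j) = (2, 0)
      · rw [hc, ← h20, h0, h20]
        simp
      · by_cases h04 : (i, j) = (0, 4)
        · rw [← h04, h0, h04]
          simp
        · rw [Finsupp.single_eq_of_ne h20, Finsupp.single_eq_of_ne h04]
          simp
    · have h1 := nonneg_of_coeffs_ne_zero h0
      have h2 := wF (i - 1) j (.inl (by simpa using h0))
      simp only at h1
      obtain ⟨rfl, rfl⟩ | ⟨rfl, rfl⟩ | ⟨rfl, rfl⟩ :
        (i = 0 ∧ j = 4) ∨ (i = 1 ∧ j = 2) ∨ (i = 2 ∧ j = 0) := by omega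
      · simp
      · exact absurd hc12 h0
      · simp [hc]
  have hFy : T.F (y q) = c • (x q * y q) + coeffs (T.F (y q)) (0, 3) • y q ^ 3 := by
    have e1 : coeffs (x q * y q) = Finsupp.single (1, 1) 1 := by
      simpa using coeffs_monomial (q := q) 1 1
    have e2 : coeffs (y q ^ 3) = Finsupp.single (0, 3) 1 := by
      simpa using coeffs_monomial (q := q) 0 3
    refine ext_coeffs fun i j => ?_
    rw [map_add, map_smul, map_smul, Finsupp.add_apply, Finsupp.smul_apply, Finsupp.smul_apply, e1,
      e2, hcd]
    by_cases h0 : coeffs (T.F (y q)) (i, j) = 0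
    · rw [h0]
      by_cases h20 : (i, j) = (1, 1)
      · rw [← h20, h0, h20]
        simp
      · by_cases h04 : (i, j) = (0, 3)
        · rw [← h04, h0, h04]
          simp
        · rw [Finsupp.single_eq_of_ne h20, Finsupp.single_eq_of_ne h04]
          simp
    · have h1 := nonneg_of_coeffs_ne_zero h0
      have h2 := wF i (j - 1) (.inr (by simpa using h0))
      simp only at h1
      obtain ⟨rfl, rfl⟩ | ⟨rfl, rfl⟩ : (i = 0 ∧ j = 3) ∨ (i = 1 ∧ j = 1) := by omega
      · simp
      · simp
  have h := T.E_F_x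
  have hFa : T.F (T.E (x q)) = 0 := by rw [hEx, map_smul, T.F_mul.map_one, smul_zero]
  rw [hFa, hFx] at h
  simp only [pow_succ, pow_zero, one_mul, map_add, map_smul, T.E_mul _ _, AlgHom.id_apply, hEx, hEy,
    zero_mul, mul_zero, add_zero, smul_zero, sub_zero, diag_x, mul_smul_comm, smul_mul_assoc,
    mul_one, hα] at h
  have h' := congrArg (fun p => coeffs p (1, 0)) h
  simp only [map_add, map_smul, Finsupp.add_apply, Finsupp.smul_apply, coeffs_x, smul_eq_mul,
    Finsupp.single_eq_same, mul_one] at h'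
  -- The relation on `x` reads `ca(1 + q⁻²) = -(q + q⁻¹)`, and `q² + 1` is invertible.
  have hca : c * a = -q := by
    have hq4 : (q : ℂ) ^ 2 + 1 ≠ 0 := by
      intro h0
      have : (4 : ℤ) = 0 := zpow_injective hq (by
        rw [zpow_zero, zpow_ofNat]
        linear_combination ((q : ℂ) ^ 2 - 1) * h0)
      omega
    refine mul_right_cancel₀ hq4 (mul_right_cancel₀ hq2 ?_)
    field_simp at h'
    linear_combination h'
  have ha : a ≠ 0 := by
    rintro h0
    rw [h0, mul_zero] at hca
    exact hq0 (neg_eq_zero.1 hca.symm)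
  have hc' : c = -((q : ℂ) * a⁻¹) := by
    field_simp
    exact hca
  refine ⟨a, coeffs (T.F (y q)) (0, 3), coeffs (T.F (x q)) (0, 4), ha,
    matrix_eq_iff.2 ⟨⟨hα, hβ⟩, ⟨hEx, hEy⟩, ?_, ?_⟩⟩
  · rw [← hc', ← hFx]
  · rw [← hc', ← hFy]

/-- The weights if the action does not produce constant terms. -/
theorem weights_of_coeffs_zero (hq : ∀ n : ℤ, n ≠ 0 → q ^ n ≠ 1)
    (hEx : coeffs (T.E (x q)) (0, 0) = 0) (hEy : coeffs (T.E (y q)) (0, 0) = 0)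
    (hFx : coeffs (T.F (x q)) (0, 0) = 0) (hFy : coeffs (T.F (y q)) (0, 0) = 0) :
    ((T.α : ℂ) ^ 2 = 1 ∧ (T.β : ℂ) ^ 2 = 1) ∨ ((T.α : ℂ) = q ∧ (T.β : ℂ) = (q : ℂ)⁻¹) := by
  have hq0 := q.ne_zero
  have hα0 := T.α.ne_zero
  have hβ0 := T.β.ne_zero
  have h20 : (2 : ℤ) ≠ 0 := by norm_num
  have h20' : (-2 : ℤ) ≠ 0 := by norm_num
  have h00 : ∀ k : ℤ, k ≠ 0 → (T.α : ℂ) ^ (0 : ℤ) * (T.β : ℂ) ^ (0 : ℤ) ≠ (q : ℂ) ^ k := by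
    intro k hk h
    exact hk (zpow_injective hq (by simpa using h.symm))
  -- The diagonal linear coefficients have shift `(0, 0)`, hence weight 1, which is not `q^(±2)`.
  have a10 : coeffs (T.E (x q)) (1, 0) = 0 := by
    by_contra h
    exact h00 _ h20 (weight_E (.inl (by simpa using h)))
  have b01 : coeffs (T.E (y q)) (0, 1) = 0 := by
    by_contra h
    exact h00 _ h20 (weight_E (.inr (by simpa using h)))
  have c10 : coeffs (T.F (x q)) (1, 0) = 0 := by
    by_contra h
    exact h00 _ h20' (weight_F (.inl (by simpa using h)))
  have d01 : coeffs (T.F (y q)) (0, 1) = 0 := by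
    by_contra h
    exact h00 _ h20' (weight_F (.inr (by simpa using h)))
  have lE := T.E_isSkewDer.coeffs_low hEx hEy
  have lF := T.F_isSkewDer.coeffs_low hFx hFy
  have h1 := congrArg (fun p => coeffs p (1, 0)) (T.E_F_x)
  have h2 := congrArg (fun p => coeffs p (0, 1)) (T.E_F_y)
  simp only [map_sub, Finsupp.sub_apply] at h1 h2
  rw [(lE (T.F (x q))).1, (lF (T.E (x q))).1] at h1
  rw [(lE (T.F (y q))).2, (lF (T.E (y q))).2] at h2
  simp only [map_smul, Finsupp.smul_apply, coeffs_x, coeffs_y,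
    a10, b01, c10, d01, Finsupp.single_eq_same, smul_eq_mul, mul_one, mul_zero, add_zero,
    zero_add] at h1 h2
  have hr := inv_ne_zero (sub_inv_ne_zero hq)
  -- If `y` occurred in `e(x)`, then `β = q⁻¹` and `α = q⁻³`. The commutator of the linear parts has
  -- trace zero (`h8`), which then becomes `(q⁴ - 1)(q² + 1) = 0`.
  have a01 : coeffs (T.E (x q)) (0, 1) = 0 := by
    by_contra h
    have h3 := coeffs_E_rel (T := T) (-1) 1
    have h4 : coeffs (T.E (y q)) (-1, 1 + 1) = 0 := coeffs_eq_zero (by simp) _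
    rw [h4, zero_mul] at h3
    have h5 := sub_eq_zero.1 ((mul_eq_zero.1 h3).resolve_left (by simpa using h))
    have h6 := weight_E (T := T) (m := -1) (n := 1) (.inl (by simpa using h))
    rw [zpow_neg_one] at h5
    have h7 : (T.α : ℂ) * (q : ℂ) ^ 3 = 1 := by
      rw [← h5, zpow_neg_one, zpow_one, zpow_ofNat] at h6
      field_simp at h6
      linear_combination -h6
    have h8 : (T.α : ℂ) - (T.α : ℂ)⁻¹ + (T.β - (T.β : ℂ)⁻¹) = 0 := by
      refine mul_left_cancel₀ hr ?_
      linear_combination -h1 - h2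
    have h9 : (T.α : ℂ) = ((q : ℂ) ^ 3)⁻¹ := eq_inv_of_mul_eq_one_left h7
    rw [← h5, h9] at h8
    field_simp at h8
    have h10 : ((q : ℂ) ^ 4 - 1) * ((q : ℂ) ^ 2 + 1) = 0 := by linear_combination -h8
    have h11 : (q : ℂ) ^ 4 = 1 := by
      rcases mul_eq_zero.1 h10 with h | h
      · linear_combination h
      · linear_combination ((q : ℂ) ^ 2 - 1) * h
    have : (4 : ℤ) = 0 := zpow_injective hq (by simpa using h11)
    omega
  rw [a01] at h1 h2
  -- If `e` vanishes on linear terms, so do the diagonal entries of the commutator. Otherwise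
  -- compatibility at the shift `(1, -1)` gives `α = q`, and the weight gives `β`.
  by_cases hb : coeffs (T.E (y q)) (1, 0) = 0
  · left
    rw [hb] at h1 h2
    constructor
    · exact sq_eq_one_of_sub_inv ((mul_eq_zero.1 (by simpa using h1.symm)).resolve_left hr)
    · exact sq_eq_one_of_sub_inv ((mul_eq_zero.1 (by simpa using h2.symm)).resolve_left hr)
  · right
    have h3 := coeffs_E_rel (T := T) 1 (-1)
    have h4 : coeffs (T.E (x q)) (1 + 1, -1) = 0 := coeffs_eq_zero (by simp) _
    rw [h4, zero_mul] at h3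
    have h5 := (mul_eq_zero.1 h3.symm).resolve_left (by simpa using hb)
    have h6 := weight_E (T := T) (m := 1) (n := -1) (.inr (by simpa using hb))
    have hα : (T.α : ℂ) = q := by
      rw [zpow_neg_one] at h5
      field_simp at h5
      linear_combination -h5
    refine ⟨hα, ?_⟩
    rw [hα, zpow_neg_one, zpow_one, zpow_ofNat] at h6
    field_simp at h6 ⊢
    linear_combination -h6

/-- A constant term in `e(x)` has shift `(-1, 0)`. Its partner in `e(y)` would have a negative
exponent, so the compatibility relation forces `β = q⁻¹`, and the weight of the shift gives `α`. -/
theorem weights_of_E_x (h : coeffs (T.E (x q)) (0, 0) ≠ 0) :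
    (T.α : ℂ) = ((q : ℂ) ^ 2)⁻¹ ∧ (T.β : ℂ) = (q : ℂ)⁻¹ := by
  have h1 := weight_E (T := T) (m := -1) (n := 0) (.inl (by simpa using h))
  have h3 := coeffs_E_rel (T := T) (-1) 0
  have h4 : coeffs (T.E (y q)) (-1, 0 + 1) = 0 := coeffs_eq_zero (by simp) _
  rw [h4, zero_mul] at h3
  have h5 := sub_eq_zero.1 ((mul_eq_zero.1 h3).resolve_left (by simpa using h))
  rw [zpow_neg_one] at h5
  rw [zpow_neg_one, zpow_zero, mul_one, zpow_ofNat] at h1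
  exact ⟨by rw [← h1, inv_inv], h5.symm⟩

theorem weights_of_E_y (h : coeffs (T.E (y q)) (0, 0) ≠ 0) :
    (T.α : ℂ) = q ∧ (T.β : ℂ) = ((q : ℂ) ^ 2)⁻¹ := by
  have h1 := weight_E (T := T) (m := 0) (n := -1) (.inr (by simpa using h))
  have h3 := coeffs_E_rel (T := T) 0 (-1)
  have h4 : coeffs (T.E (x q)) (0 + 1, -1) = 0 := coeffs_eq_zero (by simp) _
  rw [h4, zero_mul] at h3
  have h5 := (mul_eq_zero.1 h3.symm).resolve_left (by simpa using h)
  have hq0 := q.ne_zero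
  rw [zpow_neg_one] at h5
  rw [zpow_neg_one, zpow_zero, one_mul, zpow_ofNat] at h1
  refine ⟨?_, by rw [← h1, inv_inv]⟩
  field_simp at h5
  linear_combination -h5

theorem flip_flip_matrix {α β : ℂ} {ex ey fx fy : QPlane q}
    (h : T.flip.matrix = !![α • x q, β • y q; ex, ey; fx, fy]) :
    T.matrix = !![β⁻¹ • x q, α⁻¹ • y q; swap fy, swap fx; swap ey, swap ex] := by
  rw [matrix_eq_iff] at h ⊢
  simp [← h, flip]

theorem coeffs_swap_zero (p : QPlane q) : coeffs (swap p) (0, 0) = coeffs p (0, 0) := by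
  have : Finsupp.lapply (R := ℂ) (0, 0) ∘ₗ coeffs ∘ₗ swap =
      Finsupp.lapply (R := ℂ) (0, 0) ∘ₗ coeffs (q := q) := linear_ext fun m n => by
    simp [swap_mul, swap_pow, coeffs_monomial, Finsupp.single_apply, and_comm]
  exact LinearMap.congr_fun this p

/-- The action matrix of every triple is in the list. -/
theorem exists_mem_fullMatrices (hq : ∀ n : ℤ, n ≠ 0 → q ^ n ≠ 1) (T : SkewTriple q) :
    ∃ L : ListedSeries, T.matrix ∈ L.fullMatrices q := by
  by_cases hEx : coeffs (T.E (x q)) (0, 0) = 0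
  swap
  · obtain ⟨hα, hβ⟩ := weights_of_E_x hEx
    exact ⟨_, matrix_of_weights_ex hq hα hβ⟩
  by_cases hEy : coeffs (T.E (y q)) (0, 0) = 0
  swap
  · obtain ⟨hα, hβ⟩ := weights_of_E_y hEy
    exact ⟨_, matrix_of_weights_ey hq hα hβ⟩
  by_cases hFx : coeffs (T.F (x q)) (0, 0) = 0
  swap
  · obtain ⟨hα, hβ⟩ := weights_of_E_y (T := T.flip) (by simpa [flip, coeffs_swap_zero] using hFx)
    obtain ⟨b, hb, h⟩ := matrix_of_weights_ey hq hα hβ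
    refine ⟨.fx, b, hb, (flip_flip_matrix h).trans ?_⟩
    simp [swap_mul, swap_pow]
  by_cases hFy : coeffs (T.F (y q)) (0, 0) = 0
  swap
  · obtain ⟨hα, hβ⟩ := weights_of_E_x (T := T.flip) (by simpa [flip, coeffs_swap_zero] using hFy)
    obtain ⟨a, s, t, ha, h⟩ := matrix_of_weights_ex hq hα hβ
    refine ⟨.fy, a, s, t, ha, (flip_flip_matrix h).trans ?_⟩
    simp [swap_mul, swap_pow]
  rcases weights_of_coeffs_zero hq hEx hEy hFx hFy with ⟨hα, hβ⟩ | ⟨hα, hβ⟩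
  · exact ⟨_, matrix_of_sq_eq_one hq hα hβ⟩
  · exact ⟨_, matrix_of_weights_standard hq hα hβ⟩

end SkewTriple

/-! ### The classification theorem. -/

theorem mainTheorem7 (q : ℂˣ) (hq : ∀ n : ℤ, n ≠ 0 → q ^ n ≠ 1) :
    -- every structure belongs to one of the six listed series
    (∀ π : QPlaneAction q, ∃ L : ListedSeries, π ∈ L.toSet q) ∧
    -- each listed series is nonempty, and consists exactly of the structures in the list
    (∀ L : ListedSeries, (L.toSet q).Nonempty) ∧
    (∀ (L : ListedSeries) (π : QPlaneAction q), π ∈ L.toSet q ↔ π.fullMatrix ∈ L.fullMatrices q) ∧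
    (∀ (L : ListedSeries), ∀ M ∈ L.fullMatrices q, ∃! π : QPlaneAction q, π.fullMatrix = M) ∧
    -- the series of any other pair of symbolic matrices is empty
    (∀ S₀ S₁ : SymbMatrix, (∀ L : ListedSeries, (S₀, S₁) ≠ (L.symb0, L.symb1)) →
      QPlaneAction.series q S₀ S₁ = ∅) ∧
    -- structures from different series are not isomorphic
    (∀ S₀ S₁ S₀' S₁' : SymbMatrix, (S₀, S₁) ≠ (S₀', S₁') →
      ∀ π ∈ QPlaneAction.series q S₀ S₁, ∀ π' ∈ QPlaneAction.series q S₀' S₁',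
        ¬ π.Isomorphic π') := by
  have list : ∀ π : QPlaneAction q, ∃ L : ListedSeries, π.fullMatrix ∈ L.fullMatrices q := by
    intro π
    obtain ⟨T, hT⟩ := π.exists_skewTriple hq
    obtain ⟨L, hL⟩ := T.exists_mem_fullMatrices hq
    exact ⟨L, hT ▸ hL⟩
  have cover : ∀ π : QPlaneAction q, ∃ L : ListedSeries, π ∈ L.toSet q := fun π =>
    (list π).imp fun L hL => QPlaneAction.mem_toSet_of_mem_fullMatrices L hL
  have exist : ∀ (L : ListedSeries), ∀ M ∈ L.fullMatrices q,
      ∃ π : QPlaneAction q, π.fullMatrix = M := by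
    intro L M hM
    obtain ⟨T, rfl⟩ := SkewTriple.exists_of_mem_fullMatrices hq L hM
    exact QPlaneAction.exists_of_skewTriple T
  refine ⟨cover, fun L => ?_, fun L π => ⟨fun h => ?_, fun h =>
    QPlaneAction.mem_toSet_of_mem_fullMatrices L h⟩, fun L M hM => ?_, fun S₀ S₁ hS => ?_,
    fun S₀ S₁ S₀' S₁' hS π hπ π' hπ' hiso => hS ?_⟩
  · obtain ⟨M, hM⟩ : (L.fullMatrices q).Nonempty := by
      cases L
      exacts [⟨_, 1, 1, .inl rfl, .inl rfl, rfl⟩, ⟨_, 1, one_ne_zero, rfl⟩,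
        ⟨_, 1, one_ne_zero, rfl⟩, ⟨_, 1, one_ne_zero, rfl⟩, ⟨_, 1, 0, 0, one_ne_zero, rfl⟩,
        ⟨_, 1, 0, 0, one_ne_zero, rfl⟩]
    obtain ⟨π, rfl⟩ := exist L M hM
    exact ⟨π, QPlaneAction.mem_toSet_of_mem_fullMatrices L hM⟩
  · obtain ⟨L', hL'⟩ := list π
    have h' := QPlaneAction.mem_toSet_of_mem_fullMatrices L' hL'
    -- The structure also lies in the series of the list `L'` that contains it. Distinct lists have
    -- distinct labels, so `L' = L`.
    rwa [ListedSeries.symb_injective (h.1.symm.trans h'.1) (h.2.symm.trans h'.2)]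
  · obtain ⟨π, hπ⟩ := exist L M hM
    exact ⟨π, hπ, fun π' hπ' => QPlaneAction.eq_of_fullMatrix_eq (hπ'.trans hπ.symm)⟩
  · rw [Set.eq_empty_iff_forall_notMem]
    rintro π ⟨rfl, rfl⟩
    obtain ⟨L, h0, h1⟩ := cover π
    exact hS L (by rw [h0, h1])
  · rw [← hπ.1, ← hπ.2, ← hπ'.1, ← hπ'.2, QPlaneAction.symbMatrix_eq_of_isomorphic hq hiso,
      QPlaneAction.symbMatrix_eq_of_isomorphic hq hiso]
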